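/- Let $\mathrm{Sol}^4_0$ be $\mathbb R^4$ with coordinates $(x,y,z,t)$, the group operation $(a,b,c,d)\cdot(x,y,z,t)=(a+e^{d}x,\,b+e^{d}y,\,c+e^{-2d}z,\,d+t)$ and the left-invariant metric $\tilde g=e^{-2t}(dx^2+dy^2)+e^{4t}dz^2+dt^2$. Let $M$ be a connected smooth $3$-manifold and $F:M\to\mathrm{Sol}^4_0$ a smooth immersion; give $M$ the induced metric $g$, let $h$ be the second fundamental form of $F$ and $H=\tfrac13\operatorname{trace}_g h$ its mean curvature vector. The hypersurface is called totally umbilical if $h=g\,H$, and totally geodesic if $h=0$. If $F$ is totally umbilical, then one of the following holds. (a) There are $\alpha,c\in\mathbb R$ such that $F$ takes values in the hyperplane $\{x\cos\alpha+y\sin\alpha=c\}$ and is an open map into it (so $M$ is, via $F$, an open piece of this hyperplane); moreover $F$ is totally geodesic, and $M$ does not have constant sectional curvature. (b) Around every point of $M$ there are smooth local coordinates $(u_1,u_2,u_3)$ in which $F(u_1,u_2,u_3)=(u_1,u_2,\gamma_1(u_3),\gamma_2(u_3))$, where $\gamma=(\gamma_1,\gamma_2)$ is a smooth curve, defined on an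 open interval, that satisfies $$\gamma_1''\gamma_2'-\gamma_1'\gamma_2''+5\gamma_1'(\gamma_2')^2+3e^{4\gamma_2}(\gamma_1')^3=0.$$ Conversely, if $F(M)\subseteq\{x\cos\alpha+y\sin\alpha=c\}$ for some $\alpha,c\in\mathbb R$, then $F$ is totally umbilical and totally geodesic, and $M$ does not have constant sectional curvature; and if some left translate $p\mapsto a\cdot F(p)$ of $F$, with $a\in\mathrm{Sol}^4_0$, is of the form (b), then $F$ is totally umbilical. -/

import Mathlib

open Set Matrix
open scoped Manifold ContDiff

noncomputable section

/-! ### Riemannian geometry in coordinates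

A metric on (an open subset of) `ℝⁿ` is a matrix-valued function `G`, its entries being
`G x i j = g(∂ᵢ, ∂ⱼ)` at `x`. -/

/-- The `i`-th partial derivative of `f` at `x`. -/
def pderiv {n : ℕ} {W : Type*} [NormedAddCommGroup W] [NormedSpace ℝ W]
    (i : Fin n) (f : EuclideanSpace ℝ (Fin n) → W) (x : EuclideanSpace ℝ (Fin n)) : W :=
  fderiv ℝ f x (EuclideanSpace.single i 1)

/-- The bilinear form given by a matrix: `∑ᵢⱼ Aᵢⱼ vⁱ wʲ`. -/
def bilin {n : ℕ} (A : Matrix (Fin n) (Fin n) ℝ) (v w : EuclideanSpace ℝ (Fin n)) : ℝ :=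
  ∑ i, ∑ j, A i j * v i * w j

/-- The Christoffel symbols of the Levi-Civita connection of `G`:
`Γᵏᵢⱼ = ½ ∑ₗ gᵏˡ (∂ᵢ gⱼₗ + ∂ⱼ gᵢₗ - ∂ₗ gᵢⱼ)`, so that `∇_{∂ᵢ} ∂ⱼ = ∑ₖ Γᵏᵢⱼ ∂ₖ`. -/
def christoffel {n : ℕ} (G : EuclideanSpace ℝ (Fin n) → Matrix (Fin n) (Fin n) ℝ)
    (k i j : Fin n) (x : EuclideanSpace ℝ (Fin n)) : ℝ :=
  (1 / 2) * ∑ l, (G x)⁻¹ k l *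
    (pderiv i (fun y => G y j l) x + pderiv j (fun y => G y i l) x - pderiv l (fun y => G y i j) x)

/-- The components of the Riemann curvature tensor of `G`:
`R(∂ᵢ, ∂ⱼ)∂ₖ = ∑ₗ (riemann G l k i j) ∂ₗ`, where
`R(X, Y)Z = ∇_X ∇_Y Z - ∇_Y ∇_X Z - ∇_{[X, Y]} Z`. -/
def riemann {n : ℕ} (G : EuclideanSpace ℝ (Fin n) → Matrix (Fin n) (Fin n) ℝ)
    (l k i j : Fin n) (x : EuclideanSpace ℝ (Fin n)) : ℝ :=
  pderiv i (christoffel G l j k) x - pderiv j (christoffel G l i k) x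
    + ∑ m, (christoffel G l i m x * christoffel G m j k x
      - christoffel G l j m x * christoffel G m i k x)

/-- The vector `R(v, w)w` at `x`. -/
def riemannApply {n : ℕ} (G : EuclideanSpace ℝ (Fin n) → Matrix (Fin n) (Fin n) ℝ)
    (x v w : EuclideanSpace ℝ (Fin n)) : EuclideanSpace ℝ (Fin n) :=
  WithLp.toLp 2 fun l => ∑ k, ∑ i, ∑ j, riemann G l k i j x * v i * w j * w k

/-- The sectional curvature at `x` of the plane spanned by `v` and `w`
(which have to be linearly independent). -/
def sectionalCurvature {n : ℕ} (G : EuclideanSpace ℝ (Fin n) → Matrix (Fin n) (Fin n) ℝ)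
    (x v w : EuclideanSpace ℝ (Fin n)) : ℝ :=
  bilin (G x) (riemannApply G x v w) v /
    (bilin (G x) v v * bilin (G x) w w - bilin (G x) v w ^ 2)

/-! ### Parametrized submanifolds

`X` is a local parametrization, on an open subset of `ℝᵐ`, of a submanifold of `ℝⁿ` with
the metric `G`. Tangent vectors of the submanifold are written in the coordinates of `ℝᵐ`. -/

/-- The induced metric (first fundamental form). -/
def inducedMetric {m n : ℕ} (G : EuclideanSpace ℝ (Fin n) → Matrix (Fin n) (Fin n) ℝ)
    (X : EuclideanSpace ℝ (Fin m) → EuclideanSpace ℝ (Fin n))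
    (u : EuclideanSpace ℝ (Fin m)) : Matrix (Fin m) (Fin m) ℝ :=
  Matrix.of fun i j => bilin (G (X u)) (pderiv i X u) (pderiv j X u)

/-- The ambient covariant derivative `∇_{∂ᵢ} (∂ⱼ X)` along `X`. -/
def covDeriv {m n : ℕ} (G : EuclideanSpace ℝ (Fin n) → Matrix (Fin n) (Fin n) ℝ)
    (X : EuclideanSpace ℝ (Fin m) → EuclideanSpace ℝ (Fin n))
    (i j : Fin m) (u : EuclideanSpace ℝ (Fin m)) : EuclideanSpace ℝ (Fin n) :=
  WithLp.toLp 2 fun k => pderiv i (pderiv j X) u k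
    + ∑ a, ∑ b, christoffel G k a b (X u) * pderiv i X u a * pderiv j X u b

/-- The component of the ambient vector `ξ` at `X u` that is normal to the submanifold:
`ξ` minus its orthogonal projection `∑ᵢⱼ gⁱʲ g̃(ξ, ∂ⱼX) ∂ᵢX` to the tangent space. -/
def normalPart {m n : ℕ} (G : EuclideanSpace ℝ (Fin n) → Matrix (Fin n) (Fin n) ℝ)
    (X : EuclideanSpace ℝ (Fin m) → EuclideanSpace ℝ (Fin n))
    (u : EuclideanSpace ℝ (Fin m)) (ξ : EuclideanSpace ℝ (Fin n)) : EuclideanSpace ℝ (Fin n) :=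
  ξ - ∑ i, ∑ j,
    ((inducedMetric G X u)⁻¹ i j * bilin (G (X u)) ξ (pderiv j X u)) • pderiv i X u

/-- The second fundamental form `h(∂ᵢ, ∂ⱼ)`: the normal component of `∇_{∂ᵢ} (∂ⱼ X)`. -/
def secondFundamentalForm {m n : ℕ} (G : EuclideanSpace ℝ (Fin n) → Matrix (Fin n) (Fin n) ℝ)
    (X : EuclideanSpace ℝ (Fin m) → EuclideanSpace ℝ (Fin n))
    (i j : Fin m) (u : EuclideanSpace ℝ (Fin m)) : EuclideanSpace ℝ (Fin n) :=
  normalPart G X u (covDeriv G X i j u)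

/-- The mean curvature vector `H = (1/m) trace_g h`. -/
def meanCurvatureVector {m n : ℕ} (G : EuclideanSpace ℝ (Fin n) → Matrix (Fin n) (Fin n) ℝ)
    (X : EuclideanSpace ℝ (Fin m) → EuclideanSpace ℝ (Fin n))
    (u : EuclideanSpace ℝ (Fin m)) : EuclideanSpace ℝ (Fin n) :=
  (1 / (m : ℝ)) • ∑ i, ∑ j, (inducedMetric G X u)⁻¹ i j • secondFundamentalForm G X i j u

/-! ### The space `Sol⁴₀` -/

/-- The underlying manifold of `Sol⁴₀`, with the coordinates `(x, y, z, t)`. -/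
abbrev Sol40 : Type := EuclideanSpace ℝ (Fin 4)

/-- The group operation of `Sol⁴₀`; `solMul a` is the left translation by `a`. -/
def solMul (a p : Sol40) : Sol40 :=
  !₂[a 0 + Real.exp (a 3) * p 0, a 1 + Real.exp (a 3) * p 1,
    a 2 + Real.exp (-2 * a 3) * p 2, a 3 + p 3]

/-- The metric `e^{-2t}(dx² + dy²) + e^{4t} dz² + dt²`. -/
def solMetric (p : Sol40) : Matrix (Fin 4) (Fin 4) ℝ :=
  Matrix.diagonal
    ![Real.exp (-2 * p 3), Real.exp (-2 * p 3), Real.exp (4 * p 3), 1]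

/-- The vertical hyperplane `x cos α + y sin α = c`. -/
def verticalHyperplane (α c : ℝ) : Set Sol40 :=
  {p | p 0 * Real.cos α + p 1 * Real.sin α = c}

/-! ### Hypersurfaces of `Sol⁴₀`

A hypersurface is a smooth 3-manifold `M` with an immersion `F : M → Sol⁴₀`, and carries the
metric induced by `F`. Its local parametrizations are the maps `F ∘ e.symm`, for `e` a chart of the
(maximal) smooth atlas of `M`; they are considered on `e.target`. -/

section Hypersurface

variable {M : Type*} [TopologicalSpace M] [ChartedSpace (EuclideanSpace ℝ (Fin 3)) M]

/-- `F` is a smooth immersion. -/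
def IsImmersedHypersurface (F : M → Sol40) : Prop :=
  ContMDiff (𝓡 3) (𝓡 4) ∞ F ∧ ∀ p : M, Function.Injective (mfderiv (𝓡 3) (𝓡 4) F p)

/-- `h = 0`. -/
def IsTotallyGeodesic (F : M → Sol40) : Prop :=
  ∀ e ∈ IsManifold.maximalAtlas (𝓡 3) ∞ M, ∀ u ∈ e.target, ∀ i j : Fin 3,
    secondFundamentalForm solMetric (F ∘ e.symm) i j u = 0

/-- `h(·,·) = g(·,·) H`. -/
def IsTotallyUmbilical (F : M → Sol40) : Prop :=
  ∀ e ∈ IsManifold.maximalAtlas (𝓡 3) ∞ M, ∀ u ∈ e.target, ∀ i j : Fin 3,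
    secondFundamentalForm solMetric (F ∘ e.symm) i j u =
      inducedMetric solMetric (F ∘ e.symm) u i j •
        meanCurvatureVector solMetric (F ∘ e.symm) u

/-- All tangent planes at all points of the hypersurface have the same sectional curvature,
with respect to the induced metric. -/
def HasConstantSectionalCurvature (F : M → Sol40) : Prop :=
  ∃ κ : ℝ, ∀ e ∈ IsManifold.maximalAtlas (𝓡 3) ∞ M, ∀ u ∈ e.target,
    ∀ v w : EuclideanSpace ℝ (Fin 3), LinearIndependent ℝ ![v, w] →
      sectionalCurvature (inducedMetric solMetric (F ∘ e.symm)) u v w = κ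

/-- `F` maps `M` into `P`, and the images of the open subsets of `M` (in particular the image of
`M` itself) are relatively open in `P`. -/
def IsOpenPieceOf (F : M → Sol40) (P : Set Sol40) : Prop :=
  ∀ V : Set M, IsOpen V → ∃ U : Set Sol40, IsOpen U ∧ F '' V = U ∩ P

/-- Around every point there are local coordinates `(u₁, u₂, u₃)` on `M` in which `F` reads
`(u₁, u₂, γ₁(u₃), γ₂(u₃))`, for a smooth curve `(γ₁, γ₂)` on an open interval `J` which satisfies
`γ₁'' γ₂' - γ₁' γ₂'' + 5 γ₁' (γ₂')² + 3 e^{4 γ₂} (γ₁')³ = 0`. -/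
def IsCylinderOverProfileCurve (F : M → Sol40) : Prop :=
  ∀ p : M, ∃ e ∈ IsManifold.maximalAtlas (𝓡 3) ∞ M, p ∈ e.source ∧
    ∃ (J : Set ℝ) (γ₁ γ₂ : ℝ → ℝ), IsOpen J ∧ J.OrdConnected ∧
      ContDiffOn ℝ ∞ γ₁ J ∧ ContDiffOn ℝ ∞ γ₂ J ∧
      (∀ s ∈ J, deriv (deriv γ₁) s * deriv γ₂ s - deriv γ₁ s * deriv (deriv γ₂) s
        + 5 * deriv γ₁ s * deriv γ₂ s ^ 2
        + 3 * Real.exp (4 * γ₂ s) * deriv γ₁ s ^ 3 = 0) ∧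
      ∀ u ∈ e.target, u 2 ∈ J ∧ F (e.symm u) = !₂[u 0, u 1, γ₁ (u 2), γ₂ (u 2)]

end Hypersurface

end

/-! Everything is computed in the orthonormal frame `e^t ∂x, e^t ∂y, e^{-2t} ∂z, ∂t`. Let `n` be the
frame components of a unit normal, `l` the principal curvature and `θ` the frame components of a
tangent vector. Umbilicity is then equivalent to a first-order system (the Weingarten equations,
`weingartenForm`): `dn₀ = (n₃ - l) e^{-t} dx`, `dn₁ = (n₃ - l) e^{-t} dy`, `dn₂ = -(l + 2n₃) e^{2t}
dz`, `dn₃ = (n₃ - l) dt + 3 n₂ e^{2t} dz`, pulled back to the hypersurface.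

Applying `d` once more (`IsUmbilicalWith.integrability`) yields relations that involve only `n`, `θ`
and `dl`. If neither `(n₀, n₁)` nor `(n₂, n₃)` vanished at a point, `θ₀` and `θ₁` would be
independent there, which forces `dl = 3 n₂ θ₂`; since `θ₂` and `θ₃` would also be independent, the
two remaining relations give `n₂ = n₃ = 0`, a contradiction (`IsUmbilicalWith.dichotomy`). So at
each point either `n₀ = n₁ = 0` or `n₂ = n₃ = 0`. The two closed conditions exclude each other, and
connectedness selects one of them globally (`IsTotallyUmbilical.horizontal_or_vertical`).

If `n₂ = n₃ = 0`, the equation for `dn₂` gives `l = 0`, hence `dn = 0`: the normal is locally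
constant and the image lies in one vertical hyperplane (`IsTotallyUmbilical.exists_range_subset`).
In suitable coordinates such a hyperplane carries the metric `e^{-2t} ds² + e^{4t} dz² + dt²`, which
has sectional curvatures `2` and `-1`.

If `n₀ = n₁ = 0`, then `∂x` and `∂y` are tangent, so `z` and `t` depend on one parameter only. For
such a cylinder the second fundamental form, paired with the conormal `(0, 0, -γ₂', γ₁')`, is `γ₁'
g` minus the left side of the profile equation times `ds²` (`IsCylindrical.sum_mul_covDeriv`). This
formula yields the equation in one direction and umbilicity in the other. -/

noncomputable section

set_option linter.unusedSectionVars false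

/-! ### Christoffel symbols of diagonal exponential metrics -/

/-- The metric `∑ₖ e^{cₖ xᵣ} dxₖ²`. -/
def expMetric {n : ℕ} (c : Fin n → ℝ) (r : Fin n) (x : EuclideanSpace ℝ (Fin n)) :
    Matrix (Fin n) (Fin n) ℝ :=
  Matrix.diagonal fun k => Real.exp (c k * x r)

theorem solMetric_eq_expMetric : solMetric = expMetric ![-2, -2, 4, 0] 3 := by
  funext p
  unfold solMetric expMetric
  congr 1
  funext k
  fin_cases k <;> simp

theorem hasFDerivAt_coord {n : ℕ} (r : Fin n) (x : EuclideanSpace ℝ (Fin n)) :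
    HasFDerivAt (fun y : EuclideanSpace ℝ (Fin n) => y r)
      (EuclideanSpace.proj r : EuclideanSpace ℝ (Fin n) →L[ℝ] ℝ) x :=
  (EuclideanSpace.proj r : EuclideanSpace ℝ (Fin n) →L[ℝ] ℝ).hasFDerivAt

theorem pderiv_of_hasDerivAt_coord {n : ℕ} {f : ℝ → ℝ} {f' : ℝ} (r i : Fin n)
    (x : EuclideanSpace ℝ (Fin n)) (hf : HasDerivAt f f' (x r)) :
    pderiv i (fun y => f (y r)) x = if i = r then f' else 0 := by
  have h := (hf.comp_hasFDerivAt x (hasFDerivAt_coord r x)).fderiv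
  unfold pderiv
  change fderiv ℝ (f ∘ fun y : EuclideanSpace ℝ (Fin n) => y r) x _ = _
  rw [h]
  by_cases hi : i = r
  · simp [hi]
  · simp [hi, Ne.symm hi]

theorem hasDerivAt_exp_const_mul (c t : ℝ) :
    HasDerivAt (fun s => Real.exp (c * s)) (c * Real.exp (c * t)) t := by
  have := ((hasDerivAt_id t).const_mul c).exp
  simpa [mul_comm] using this

theorem pderiv_expMetric {n : ℕ} (c : Fin n → ℝ) (r i j l : Fin n)
    (x : EuclideanSpace ℝ (Fin n)) :
    pderiv i (fun y => expMetric c r y j l) x =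
      if j = l ∧ i = r then c j * Real.exp (c j * x r) else 0 := by
  by_cases hjl : j = l
  · subst hjl
    have : (fun y => expMetric c r y j j) = fun y => (fun s => Real.exp (c j * s)) (y r) := by
      funext y; simp [expMetric]
    rw [this, pderiv_of_hasDerivAt_coord r i x (hasDerivAt_exp_const_mul (c j) (x r))]
    simp
  · have : (fun y => expMetric c r y j l) = fun _ => (0 : ℝ) := by
      funext y; simp [expMetric, hjl]
    rw [this]
    simp [hjl, pderiv]

theorem expMetric_inv {n : ℕ} (c : Fin n → ℝ) (r : Fin n) (x : EuclideanSpace ℝ (Fin n)) :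
    (expMetric c r x)⁻¹ = Matrix.diagonal fun k => Real.exp (-(c k * x r)) := by
  apply Matrix.inv_eq_left_inv
  unfold expMetric
  rw [Matrix.diagonal_mul_diagonal, ← Matrix.diagonal_one]
  congr 1
  funext k
  rw [← Real.exp_add]; simp

/-- The metric is diagonal, so only `l = k` survives in the sum. The same formula serves the ambient
space and the metric induced on a vertical hyperplane. -/
theorem christoffel_expMetric {n : ℕ} (c : Fin n → ℝ) (r k i j : Fin n)
    (x : EuclideanSpace ℝ (Fin n)) :
    christoffel (expMetric c r) k i j x =
      (1 / 2) * ((if j = k ∧ i = r then c k else 0) + (if i = k ∧ j = r then c k else 0)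
        - (if i = j ∧ k = r then c i * Real.exp ((c i - c k) * x r) else 0)) := by
  unfold christoffel
  rw [expMetric_inv]
  simp only [pderiv_expMetric]
  rw [Finset.sum_eq_single k]
  · rw [Matrix.diagonal_apply_eq]
    have e1 : Real.exp (-(c k * x r)) * Real.exp (c k * x r) = 1 := by
      rw [← Real.exp_add]; simp
    have e2 : Real.exp (-(c k * x r)) * Real.exp (c i * x r) =
        Real.exp ((c i - c k) * x r) := by
      rw [← Real.exp_add]; congr 1; ring
    congr 1
    rw [mul_sub, mul_add]
    congr 1
    · congr 1
      · split_ifs with h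
        · rw [h.1, mul_left_comm, e1, mul_one]
        · simp
      · split_ifs with h
        · rw [h.1, mul_left_comm, e1, mul_one]
        · simp
    · split_ifs with h
      · rw [mul_left_comm, e2]
      · simp
  · intro l _ hl
    rw [Matrix.diagonal_apply_ne _ (Ne.symm hl), zero_mul]
  · simp

/-- The pairing of the covector `ν` with the Christoffel part `Γ(v, w)` of the covariant derivative
of `Sol⁴₀`, at height `t`. -/
def solConn (t : ℝ) (ν : Fin 4 → ℝ) (v w : Sol40) : ℝ :=
  -ν 0 * (v 3 * w 0 + v 0 * w 3) - ν 1 * (v 3 * w 1 + v 1 * w 3) +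
    2 * ν 2 * (v 3 * w 2 + v 2 * w 3) +
    ν 3 * (Real.exp (-2 * t) * (v 0 * w 0 + v 1 * w 1) - 2 * Real.exp (4 * t) * (v 2 * w 2))

theorem sum_mul_christoffel_solMetric (p : Sol40) (ν : Fin 4 → ℝ) (v w : Sol40) :
    ∑ k, ν k * ∑ a, ∑ b, christoffel solMetric k a b p * v a * w b = solConn (p 3) ν v w := by
  rw [solMetric_eq_expMetric]
  simp only [christoffel_expMetric]
  simp [Fin.sum_univ_four, solConn]
  ring

theorem bilin_solMetric (p v w : Sol40) :
    bilin (solMetric p) v w = Real.exp (-2 * p 3) * (v 0 * w 0 + v 1 * w 1) +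
      Real.exp (4 * p 3) * (v 2 * w 2) + v 3 * w 3 := by
  simp [bilin, solMetric, Fin.sum_univ_four, Matrix.diagonal]
  ring

/-! ### Linear algebra of the normal bundle -/

/-- `bilin A` as a bilinear map. -/
def bilinMap {n : ℕ} (A : Matrix (Fin n) (Fin n) ℝ) :
    EuclideanSpace ℝ (Fin n) →ₗ[ℝ] EuclideanSpace ℝ (Fin n) →ₗ[ℝ] ℝ :=
  LinearMap.mk₂ ℝ (bilin A)
    (by intro a b c; simp [bilin, mul_add, add_mul, Finset.sum_add_distrib])
    (by intro r a b; simp only [bilin, Finset.mul_sum, PiLp.smul_apply, smul_eq_mul]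
        exact Finset.sum_congr rfl fun i _ => Finset.sum_congr rfl fun j _ => by ring)
    (by intro a b c; simp [bilin, mul_add, Finset.sum_add_distrib])
    (by intro r a b; simp only [bilin, Finset.mul_sum, PiLp.smul_apply, smul_eq_mul]
        exact Finset.sum_congr rfl fun i _ => Finset.sum_congr rfl fun j _ => by ring)

theorem bilinMap_apply {n : ℕ} (A : Matrix (Fin n) (Fin n) ℝ) (v w : EuclideanSpace ℝ (Fin n)) :
    bilinMap A v w = bilin A v w := rfl

theorem bilin_solMetric_comm (p v w : Sol40) :
    bilin (solMetric p) v w = bilin (solMetric p) w v := by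
  simp only [bilin_solMetric]; ring

theorem eq_zero_of_bilin_solMetric_self {p v : Sol40} (h : bilin (solMetric p) v v = 0) :
    v = 0 := by
  rw [bilin_solMetric] at h
  have h1 := Real.exp_pos (-2 * p 3)
  have h2 := Real.exp_pos (4 * p 3)
  have a0 := mul_nonneg h1.le (mul_self_nonneg (v 0))
  have a1 := mul_nonneg h1.le (mul_self_nonneg (v 1))
  have a2 := mul_nonneg h2.le (mul_self_nonneg (v 2))
  have a3 := mul_self_nonneg (v 3)
  rw [mul_add] at h
  have b0 : Real.exp (-2 * p 3) * (v 0 * v 0) = 0 := by linarith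
  have b1 : Real.exp (-2 * p 3) * (v 1 * v 1) = 0 := by linarith
  have b2 : Real.exp (4 * p 3) * (v 2 * v 2) = 0 := by linarith
  have b3 : v 3 * v 3 = 0 := by linarith
  ext k
  fin_cases k
  · simpa [h1.ne'] using b0
  · simpa [h1.ne'] using b1
  · simpa [h2.ne'] using b2
  · simpa using b3

/-- The vector that corresponds to the covector `ν` under the metric of `Sol⁴₀`. -/
def solSharp (p : Sol40) (ν : Fin 4 → ℝ) : Sol40 :=
  !₂[Real.exp (2 * p 3) * ν 0, Real.exp (2 * p 3) * ν 1, Real.exp (-4 * p 3) * ν 2, ν 3]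

theorem bilin_solSharp (p ξ : Sol40) (ν : Fin 4 → ℝ) :
    bilin (solMetric p) ξ (solSharp p ν) = ∑ k, ν k * ξ k := by
  rw [bilin_solMetric, Fin.sum_univ_four]
  have h1 : Real.exp (-2 * p 3) * Real.exp (2 * p 3) = 1 := by
    rw [← Real.exp_add]; ring_nf; simp
  have h2 : Real.exp (4 * p 3) * Real.exp (-4 * p 3) = 1 := by
    rw [← Real.exp_add]; ring_nf; simp
  simp only [solSharp, PiLp.toLp_apply, Matrix.cons_val]
  linear_combination (ν 0 * ξ 0 + ν 1 * ξ 1) * h1 + (ν 2 * ξ 2) * h2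

theorem solSharp_ne_zero (p : Sol40) {ν : Fin 4 → ℝ} (hν : ν ≠ 0) : solSharp p ν ≠ 0 := by
  intro h
  apply hν
  have h0 := congrArg (fun v : Sol40 => v 0) h
  have h1 := congrArg (fun v : Sol40 => v 1) h
  have h2 := congrArg (fun v : Sol40 => v 2) h
  have h3 := congrArg (fun v : Sol40 => v 3) h
  simp [solSharp] at h0 h1 h2 h3
  funext k
  fin_cases k <;> assumption

/-- An injective linear map from `ℝ³` to `ℝ⁴` whose range is annihilated by the nonzero covector
`ν` maps onto the kernel of `ν`. -/
theorem exists_eq_of_annihilator {L : EuclideanSpace ℝ (Fin 3) →ₗ[ℝ] (Fin 4 → ℝ)}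
    (hL : Function.Injective L) {ν : Fin 4 → ℝ} (hν : ν ≠ 0)
    (hLν : ∀ w, ∑ k, ν k * L w k = 0) {y : Fin 4 → ℝ} (hy : ∑ k, ν k * y k = 0) :
    ∃ w, L w = y := by
  let f : (Fin 4 → ℝ) →ₗ[ℝ] ℝ := Fintype.linearCombination ℝ ν
  have hf : ∀ z, f z = ∑ k, ν k * z k := by
    intro z; simp [f, Fintype.linearCombination_apply, mul_comm]
  have hle : LinearMap.range L ≤ LinearMap.ker f := by
    rintro _ ⟨w, rfl⟩
    rw [LinearMap.mem_ker, hf, hLν]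
  have hr : Module.finrank ℝ (LinearMap.range L) = 3 := by
    rw [LinearMap.finrank_range_of_inj hL]; simp
  have hf0 : f ≠ 0 := by
    intro h
    apply hν
    funext k
    have := LinearMap.congr_fun h (Pi.single k 1)
    rw [hf] at this
    simpa [Pi.single_apply] using this
  have hs : LinearMap.range f = ⊤ := LinearMap.range_eq_top.2 (LinearMap.surjective hf0)
  have hk := LinearMap.finrank_range_add_finrank_ker f
  rw [hs, finrank_top] at hk
  simp at hk
  have heq : LinearMap.range L = LinearMap.ker f :=
    Submodule.eq_of_le_of_finrank_eq hle (by rw [hr]; omega)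
  have : y ∈ LinearMap.range L := by rw [heq, LinearMap.mem_ker, hf, hy]
  exact this

theorem fderiv_apply_eq_sum_pderiv {m : ℕ} {W : Type*} [NormedAddCommGroup W] [NormedSpace ℝ W]
    (f : EuclideanSpace ℝ (Fin m) → W) (u w : EuclideanSpace ℝ (Fin m)) :
    fderiv ℝ f u w = ∑ i, w i • pderiv i f u := by
  have hw : w = ∑ i, w i • EuclideanSpace.single i (1 : ℝ) := by
    have := (EuclideanSpace.basisFun (Fin m) ℝ).sum_repr w
    simpa using this.symm
  conv_lhs => rw [hw]
  simp [map_sum, pderiv]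

section Normal

variable {X : EuclideanSpace ℝ (Fin 3) → Sol40} {u : EuclideanSpace ℝ (Fin 3)}

theorem inducedMetric_comm (i j : Fin 3) :
    inducedMetric solMetric X u i j = inducedMetric solMetric X u j i :=
  bilin_solMetric_comm _ _ _

theorem bilin_fderiv_pderiv (w : EuclideanSpace ℝ (Fin 3)) (j : Fin 3) :
    bilin (solMetric (X u)) (fderiv ℝ X u w) (pderiv j X u) =
      ∑ i, w i * inducedMetric solMetric X u i j := by
  rw [← bilinMap_apply, fderiv_apply_eq_sum_pderiv]
  simp [map_sum, bilinMap_apply, inducedMetric]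

/-- A null vector of the Gram matrix gives a tangent vector orthogonal to all tangent vectors,
itself included; positivity of the metric and injectivity of the differential make it zero. -/
theorem isUnit_det_inducedMetric (hX : Function.Injective (fderiv ℝ X u)) :
    IsUnit (inducedMetric solMetric X u).det := by
  rw [isUnit_iff_ne_zero]
  intro h
  obtain ⟨v, hv0, hv⟩ := Matrix.exists_mulVec_eq_zero_iff.2 h
  apply hv0
  set w : EuclideanSpace ℝ (Fin 3) := WithLp.toLp 2 v with hw
  have hortho : ∀ j, bilin (solMetric (X u)) (fderiv ℝ X u w) (pderiv j X u) = 0 := by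
    intro j
    rw [bilin_fderiv_pderiv]
    have := congrFun hv j
    simp only [Matrix.mulVec, dotProduct, Pi.zero_apply] at this
    rw [← this]
    exact Finset.sum_congr rfl fun i _ => by rw [inducedMetric_comm, mul_comm]
  have hself : bilin (solMetric (X u)) (fderiv ℝ X u w) (fderiv ℝ X u w) = 0 := by
    rw [← bilinMap_apply]
    nth_rewrite 2 [fderiv_apply_eq_sum_pderiv]
    simp [map_sum, bilinMap_apply, hortho]
  have h0 := eq_zero_of_bilin_solMetric_self hself
  have hw0 : w = 0 := hX (by rw [h0, map_zero])
  funext k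
  simpa [hw] using congrArg (fun z : EuclideanSpace ℝ (Fin 3) => z k) hw0

theorem bilin_normalPart_pderiv (hX : Function.Injective (fderiv ℝ X u)) (ξ : Sol40) (j : Fin 3) :
    bilin (solMetric (X u)) (normalPart solMetric X u ξ) (pderiv j X u) = 0 := by
  have hinv := Matrix.mul_nonsing_inv _ (isUnit_det_inducedMetric hX)
  rw [← bilinMap_apply, normalPart]
  simp only [map_sub, map_sum, map_smul, LinearMap.sub_apply, LinearMap.sum_apply,
    LinearMap.smul_apply, smul_eq_mul, bilinMap_apply]
  rw [sub_eq_zero, Finset.sum_comm]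
  have : ∀ b, ∑ a, (inducedMetric solMetric X u)⁻¹ a b * bilin (solMetric (X u)) ξ (pderiv b X u) *
      bilin (solMetric (X u)) (pderiv a X u) (pderiv j X u) =
      (if j = b then 1 else 0) * bilin (solMetric (X u)) ξ (pderiv b X u) := by
    intro b
    have h := congrFun (congrFun hinv j) b
    rw [Matrix.mul_apply, Matrix.one_apply] at h
    rw [← h, Finset.sum_mul]
    refine Finset.sum_congr rfl fun a _ => ?_
    rw [inducedMetric_comm j a]
    change _ = bilin (solMetric (X u)) (pderiv a X u) (pderiv j X u) * _ * _
    ring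
  simp [this]

theorem bilin_normalPart_of_normal {N : Sol40}
    (hN : ∀ j, bilin (solMetric (X u)) (pderiv j X u) N = 0) (ξ : Sol40) :
    bilin (solMetric (X u)) (normalPart solMetric X u ξ) N = bilin (solMetric (X u)) ξ N := by
  rw [← bilinMap_apply, normalPart]
  simp [map_sum, bilinMap_apply, hN]

theorem pderiv_mem_annihilator {ν : Fin 4 → ℝ} (hν : ∀ w, ∑ k, ν k * fderiv ℝ X u w k = 0)
    (j : Fin 3) : bilin (solMetric (X u)) (pderiv j X u) (solSharp (X u) ν) = 0 := by
  rw [bilin_solSharp]; exact hν _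

/-- A normal vector is determined by its pairing with a conormal. -/
theorem eq_zero_of_normal (hX : Function.Injective (fderiv ℝ X u)) {ν : Fin 4 → ℝ} (hν0 : ν ≠ 0)
    (hν : ∀ w, ∑ k, ν k * fderiv ℝ X u w k = 0) {η : Sol40}
    (hη : ∀ j, bilin (solMetric (X u)) η (pderiv j X u) = 0) (hην : ∑ k, ν k * η k = 0) :
    η = 0 := by
  let L : EuclideanSpace ℝ (Fin 3) →ₗ[ℝ] (Fin 4 → ℝ) :=
    (WithLp.linearEquiv 2 ℝ (Fin 4 → ℝ)).toLinearMap ∘ₗ (fderiv ℝ X u).toLinearMap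
  have hL : Function.Injective L := (WithLp.linearEquiv 2 ℝ (Fin 4 → ℝ)).injective.comp hX
  -- Being killed by the conormal makes `η` tangent; being normal as well, it is orthogonal to
  -- itself.
  obtain ⟨w, hw⟩ := exists_eq_of_annihilator (L := L) hL hν0 hν (y := WithLp.ofLp η) hην
  have hw' : fderiv ℝ X u w = η := (WithLp.linearEquiv 2 ℝ (Fin 4 → ℝ)).injective hw
  apply eq_zero_of_bilin_solMetric_self (p := X u)
  nth_rewrite 2 [← hw']
  rw [fderiv_apply_eq_sum_pderiv, ← bilinMap_apply]
  simp [map_sum, bilinMap_apply, hη]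

/-- The second fundamental form, paired with a conormal. -/
theorem sum_mul_secondFundamentalForm {ν : Fin 4 → ℝ}
    (hν : ∀ w, ∑ k, ν k * fderiv ℝ X u w k = 0) (i j : Fin 3) :
    ∑ k, ν k * secondFundamentalForm solMetric X i j u k =
      ∑ k, ν k * covDeriv solMetric X i j u k := by
  rw [← bilin_solSharp (X u), ← bilin_solSharp (X u)]
  exact bilin_normalPart_of_normal (pderiv_mem_annihilator hν) _

/-- The normal space is the line spanned by the metric dual of `ν`, so pairing with `ν` fixes the
coefficient. -/
theorem secondFundamentalForm_eq_smul (hX : Function.Injective (fderiv ℝ X u)) {ν : Fin 4 → ℝ}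
    (hν0 : ν ≠ 0) (hν : ∀ w, ∑ k, ν k * fderiv ℝ X u w k = 0) (i j : Fin 3) :
    secondFundamentalForm solMetric X i j u =
      ((∑ k, ν k * covDeriv solMetric X i j u k) / ∑ k, ν k * solSharp (X u) ν k) •
        solSharp (X u) ν := by
  set N := solSharp (X u) ν with hN
  have hb : ∑ k, ν k * N k ≠ 0 := by
    rw [← bilin_solSharp (X u)]
    exact fun h => solSharp_ne_zero (X u) hν0 (eq_zero_of_bilin_solMetric_self h)
  rw [← sub_eq_zero]
  apply eq_zero_of_normal hX hν0 hν
  · intro j'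
    rw [← bilinMap_apply, map_sub, map_smul, LinearMap.sub_apply, LinearMap.smul_apply,
      bilinMap_apply, bilinMap_apply, bilin_solMetric_comm _ N, pderiv_mem_annihilator hν]
    unfold secondFundamentalForm
    rw [bilin_normalPart_pderiv hX]
    simp
  · have h1 := sum_mul_secondFundamentalForm hν i j
    simp only [PiLp.sub_apply, PiLp.smul_apply, smul_eq_mul, mul_sub, Finset.sum_sub_distrib, h1]
    rw [sub_eq_zero]
    have : ∀ c : ℝ, ∑ k, ν k * (c * N k) = c * ∑ k, ν k * N k := by
      intro c; rw [Finset.mul_sum]; exact Finset.sum_congr rfl fun k _ => by ring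
    rw [this, div_mul_cancel₀ _ hb]

/-- Umbilicity at a point, expressed through a conormal. -/
theorem umbilical_iff_exists (hX : Function.Injective (fderiv ℝ X u)) {ν : Fin 4 → ℝ}
    (hν0 : ν ≠ 0) (hν : ∀ w, ∑ k, ν k * fderiv ℝ X u w k = 0) :
    (∀ i j : Fin 3, secondFundamentalForm solMetric X i j u =
      inducedMetric solMetric X u i j • meanCurvatureVector solMetric X u) ↔
    ∃ l : ℝ, ∀ i j : Fin 3, ∑ k, ν k * covDeriv solMetric X i j u k =
      l * inducedMetric solMetric X u i j := by
  constructor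
  · intro h
    refine ⟨∑ k, ν k * meanCurvatureVector solMetric X u k, fun i j => ?_⟩
    rw [← sum_mul_secondFundamentalForm hν, h i j, Finset.sum_mul]
    exact Finset.sum_congr rfl fun k _ => by
      simp only [PiLp.smul_apply, smul_eq_mul]; ring
  · rintro ⟨l, hl⟩
    set N := solSharp (X u) ν with hN
    set b := ∑ k, ν k * N k with hb
    have hs : ∀ i j, secondFundamentalForm solMetric X i j u =
        inducedMetric solMetric X u i j • (l / b) • N := by
      intro i j
      rw [secondFundamentalForm_eq_smul hX hν0 hν, hl, smul_smul]
      congr 1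
      rw [← hb]; ring
    -- The trace of `g⁻¹ g` is `3`, which cancels the factor `1/3` in the definition of the mean
    -- curvature.
    have hH : meanCurvatureVector solMetric X u = (l / b) • N := by
      unfold meanCurvatureVector
      have hinv := Matrix.nonsing_inv_mul _ (isUnit_det_inducedMetric hX)
      have htr : ∑ i, ∑ j, (inducedMetric solMetric X u)⁻¹ i j *
          inducedMetric solMetric X u i j = 3 := by
        have : ∀ i, ∑ j, (inducedMetric solMetric X u)⁻¹ i j *
            inducedMetric solMetric X u i j = 1 := by
          intro i
          have h := congrFun (congrFun hinv i) i
          rw [Matrix.mul_apply, Matrix.one_apply_eq] at h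
          rw [← h]
          exact Finset.sum_congr rfl fun j _ => by rw [inducedMetric_comm]
        simp [this]
      simp only [hs]
      simp only [smul_smul, ← Finset.sum_smul]
      congr 1
      have : ∑ i, ∑ j, (inducedMetric solMetric X u)⁻¹ i j *
          (inducedMetric solMetric X u i j * (l / b)) = 3 * (l / b) := by
        rw [← htr, Finset.sum_mul]
        refine Finset.sum_congr rfl fun i _ => ?_
        rw [Finset.sum_mul]
        exact Finset.sum_congr rfl fun j _ => by ring
      simp only [← mul_assoc] at this ⊢
      rw [this]; norm_num; ring
    intro i j
    rw [hs, hH]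

theorem secondFundamentalForm_eq_zero (hX : Function.Injective (fderiv ℝ X u)) {ν : Fin 4 → ℝ}
    (hν0 : ν ≠ 0) (hν : ∀ w, ∑ k, ν k * fderiv ℝ X u w k = 0) {i j : Fin 3}
    (h : ∑ k, ν k * covDeriv solMetric X i j u k = 0) :
    secondFundamentalForm solMetric X i j u = 0 := by
  rw [secondFundamentalForm_eq_smul hX hν0 hν, h]; simp

end Normal

/-- The second fundamental form in terms of the first derivatives of a conormal field. -/
theorem sum_mul_covDeriv {X : EuclideanSpace ℝ (Fin 3) → Sol40} {u : EuclideanSpace ℝ (Fin 3)}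
    {ν : EuclideanSpace ℝ (Fin 3) → Fin 4 → ℝ} (hX : ContDiffAt ℝ 2 X u)
    (hνd : DifferentiableAt ℝ ν u)
    (hν : ∀ᶠ u' in nhds u, ∀ w, ∑ k, ν u' k * fderiv ℝ X u' w k = 0) (i j : Fin 3) :
    ∑ k, ν u k * covDeriv solMetric X i j u k =
      -(∑ k, pderiv i ν u k * pderiv j X u k) +
        solConn (X u 3) (ν u) (pderiv i X u) (pderiv j X u) := by
  have hXd : DifferentiableAt ℝ (pderiv j X) u := by
    have : DifferentiableAt ℝ (fderiv ℝ X) u :=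
      (hX.fderiv_right (m := 1) (by norm_num)).differentiableAt (by norm_num)
    exact this.clm_apply (differentiableAt_const _)
  -- Differentiating the identity `ν · ∂ⱼX = 0` moves the second derivative of `X` onto `ν`, so only
  -- first derivatives of the conormal remain.
  have key : ∑ k, ν u k * pderiv i (pderiv j X) u k = -∑ k, pderiv i ν u k * pderiv j X u k := by
    have hz : (fun u' => ∑ k, ν u' k * pderiv j X u' k) =ᶠ[nhds u] fun _ => 0 := by
      filter_upwards [hν] with u' hu'
      exact hu' _
    have h1 : HasFDerivAt (fun u' => ∑ k, ν u' k * pderiv j X u' k)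
        (∑ k, (ν u k • ((EuclideanSpace.proj k : Sol40 →L[ℝ] ℝ).comp (fderiv ℝ (pderiv j X) u)) +
          pderiv j X u k • ((ContinuousLinearMap.proj k : (Fin 4 → ℝ) →L[ℝ] ℝ).comp
            (fderiv ℝ ν u)))) u := by
      apply HasFDerivAt.fun_sum
      intro k _
      apply HasFDerivAt.mul
      · exact (ContinuousLinearMap.proj k : (Fin 4 → ℝ) →L[ℝ] ℝ).hasFDerivAt.comp u
          hνd.hasFDerivAt
      · exact (EuclideanSpace.proj k : Sol40 →L[ℝ] ℝ).hasFDerivAt.comp u hXd.hasFDerivAt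
    have h2 := h1.unique ((hasFDerivAt_const (0 : ℝ) u).congr_of_eventuallyEq hz)
    have h3 := congrArg (fun T : EuclideanSpace ℝ (Fin 3) →L[ℝ] ℝ =>
      T (EuclideanSpace.single i 1)) h2
    simp only [_root_.sum_apply, _root_.add_apply,
      _root_.smul_apply, ContinuousLinearMap.comp_apply,
      _root_.zero_apply, smul_eq_mul, Finset.sum_add_distrib,
      ContinuousLinearMap.proj_apply, PiLp.proj_apply] at h3
    rw [eq_neg_iff_add_eq_zero, ← h3]
    congr 1
    exact Finset.sum_congr rfl fun k _ => mul_comm _ _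
  rw [← key, ← sum_mul_christoffel_solMetric, ← Finset.sum_add_distrib]
  exact Finset.sum_congr rfl fun k _ => by rw [← mul_add]; rfl

/-! ### The unit normal and the Weingarten equations -/

/-- The components of `v` in the orthonormal frame `e^t ∂x, e^t ∂y, e^{-2t} ∂z, ∂t`. -/
def solFrame (t : ℝ) (v : Sol40) : Fin 4 → ℝ :=
  ![Real.exp (-t) * v 0, Real.exp (-t) * v 1, Real.exp (2 * t) * v 2, v 3]

/-- The covector with components `n` in the dual frame. -/
def solCoframe (t : ℝ) (n : Fin 4 → ℝ) : Fin 4 → ℝ :=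
  ![Real.exp (-t) * n 0, Real.exp (-t) * n 1, Real.exp (2 * t) * n 2, n 3]

theorem sum_solCoframe_mul (t : ℝ) (n : Fin 4 → ℝ) (v : Sol40) :
    ∑ k, solCoframe t n k * v k = ∑ k, n k * solFrame t v k := by
  simp [Fin.sum_univ_four, solCoframe, solFrame]; ring

theorem solCoframe_ne_zero (t : ℝ) {n : Fin 4 → ℝ} (hn : n ≠ 0) : solCoframe t n ≠ 0 := by
  intro h
  apply hn
  have h0 := congrFun h 0
  have h1 := congrFun h 1
  have h2 := congrFun h 2
  have h3 := congrFun h 3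
  simp [solCoframe] at h0 h1 h2 h3
  funext k
  fin_cases k <;> assumption

theorem solCoframe_neg_solCoframe (t : ℝ) (n : Fin 4 → ℝ) :
    solCoframe t (solCoframe (-t) n) = n := by
  have h1 : Real.exp (-t) * Real.exp t = 1 := by rw [← Real.exp_add]; simp
  have h2 : Real.exp (2 * t) * Real.exp (-(2 * t)) = 1 := by rw [← Real.exp_add]; simp
  funext k
  fin_cases k <;> simp [solCoframe, ← mul_assoc, h1, h2]

/-! ### Conormals from the minors of the differential -/

/-- The generalized cross product of three vectors of `ℝ⁴`, as a covector. -/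
def crossCovector (a : Fin 3 → Sol40) (k : Fin 4) : ℝ :=
  (-1) ^ (k : ℕ) * (Matrix.of fun i j => a i (k.succAbove j)).det

/-- Laplace expansion along the row `w`. -/
theorem sum_crossCovector_mul (a : Fin 3 → Sol40) (w : Sol40) :
    ∑ k, crossCovector a k * w k =
      (Matrix.of (Fin.cons (WithLp.ofLp w) fun i => WithLp.ofLp (a i)) :
        Matrix (Fin 4) (Fin 4) ℝ).det := by
  rw [Matrix.det_succ_row_zero]
  refine Finset.sum_congr rfl fun k _ => ?_
  have : (Matrix.of fun i j => a i (k.succAbove j)) =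
      (Matrix.of (Fin.cons (WithLp.ofLp w) fun i => WithLp.ofLp (a i)) :
        Matrix (Fin 4) (Fin 4) ℝ).submatrix Fin.succ k.succAbove := by
    ext i j; simp
  rw [crossCovector, this]
  simp
  ring

theorem sum_crossCovector_mul_self (a : Fin 3 → Sol40) (i : Fin 3) :
    ∑ k, crossCovector a k * a i k = 0 := by
  rw [sum_crossCovector_mul]
  apply Matrix.det_zero_of_row_eq (i := 0) (j := i.succ) (Fin.succ_ne_zero i).symm
  rfl

/-- The three images are independent, hence complete to a basis by some `w`; the pairing with `w` is
the determinant of that basis. -/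
theorem crossCovector_ne_zero {L : EuclideanSpace ℝ (Fin 3) →L[ℝ] Sol40}
    (hL : Function.Injective L) :
    crossCovector (fun i => L (EuclideanSpace.single i 1)) ≠ 0 := by
  intro h0
  have hind : LinearIndependent ℝ fun i : Fin 3 => L (EuclideanSpace.single i 1) := by
    have := (EuclideanSpace.basisFun (Fin 3) ℝ).toBasis.linearIndependent.map'
      L.toLinearMap (LinearMap.ker_eq_bot.2 hL)
    have heq : (L.toLinearMap ∘ (EuclideanSpace.basisFun (Fin 3) ℝ).toBasis) =
        fun i : Fin 3 => L (EuclideanSpace.single i 1) := by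
      funext i; simp
    rwa [heq] at this
  obtain ⟨w, hw⟩ : ∃ w : Sol40,
      w ∉ Submodule.span ℝ (range fun i : Fin 3 => L (EuclideanSpace.single i 1)) := by
    by_contra! hcon
    have htop : Submodule.span ℝ (range fun i : Fin 3 => L (EuclideanSpace.single i 1)) = ⊤ :=
      eq_top_iff.2 fun w _ => hcon w
    have := finrank_span_eq_card hind
    rw [htop, finrank_top] at this
    simp at this
  have hcons := linearIndependent_finCons.2 ⟨hind, hw⟩
  have hcons' := hcons.map' (WithLp.linearEquiv 2 ℝ (Fin 4 → ℝ)).toLinearMap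
    (LinearEquiv.ker _)
  have hdet := sum_crossCovector_mul (fun i => L (EuclideanSpace.single i 1)) w
  rw [h0] at hdet
  simp only [Pi.zero_apply, zero_mul, Finset.sum_const_zero] at hdet
  have hunit : IsUnit (Matrix.of (Fin.cons (WithLp.ofLp w) fun i : Fin 3 => WithLp.ofLp
      (L (EuclideanSpace.single i 1))) : Matrix (Fin 4) (Fin 4) ℝ) := by
    rw [← Matrix.linearIndependent_rows_iff_isUnit]
    have heq : ((WithLp.linearEquiv 2 ℝ (Fin 4 → ℝ)).toLinearMap ∘
        (Fin.cons w fun i : Fin 3 => L (EuclideanSpace.single i 1) : Fin 4 → Sol40)) =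
        Matrix.row (Matrix.of (Fin.cons (WithLp.ofLp w) fun i : Fin 3 => WithLp.ofLp
          (L (EuclideanSpace.single i 1))) : Matrix (Fin 4) (Fin 4) ℝ) := by
      funext k
      refine Fin.cases rfl (fun i => rfl) k
    rwa [heq] at hcons'
  rw [Matrix.isUnit_iff_isUnit_det, ← hdet] at hunit
  simp at hunit

/-! ### Smooth unit normals -/

section

variable {Ω : Set (EuclideanSpace ℝ (Fin 3))} {X : EuclideanSpace ℝ (Fin 3) → Sol40}

theorem contDiffOn_pderiv (hΩ : IsOpen Ω) (hX : ContDiffOn ℝ ∞ X Ω) (i : Fin 3) :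
    ContDiffOn ℝ ∞ (pderiv i X) Ω :=
  (hX.fderiv_of_isOpen hΩ (by simp)).clm_apply contDiffOn_const

theorem contDiffOn_coord {n : ℕ} {Y : EuclideanSpace ℝ (Fin 3) → EuclideanSpace ℝ (Fin n)}
    (hY : ContDiffOn ℝ ∞ Y Ω) (k : Fin n) : ContDiffOn ℝ ∞ (fun u => Y u k) Ω :=
  (EuclideanSpace.proj k : EuclideanSpace ℝ (Fin n) →L[ℝ] ℝ).contDiff.comp_contDiffOn hY

theorem fderiv_coord {n m : ℕ} {Y : EuclideanSpace ℝ (Fin m) → EuclideanSpace ℝ (Fin n)}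
    {u : EuclideanSpace ℝ (Fin m)} (hY : DifferentiableAt ℝ Y u) (k : Fin n)
    (w : EuclideanSpace ℝ (Fin m)) : fderiv ℝ (fun u => Y u k) u w = fderiv ℝ Y u w k := by
  have := ((EuclideanSpace.proj k : EuclideanSpace ℝ (Fin n) →L[ℝ] ℝ).hasFDerivAt.comp u
    hY.hasFDerivAt).fderiv
  change fderiv ℝ ((EuclideanSpace.proj k : EuclideanSpace ℝ (Fin n) →L[ℝ] ℝ) ∘ Y) u w = _
  rw [this]; rfl

theorem contDiffOn_crossCovector (hΩ : IsOpen Ω) (hX : ContDiffOn ℝ ∞ X Ω) (k : Fin 4) :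
    ContDiffOn ℝ ∞ (fun u => crossCovector (fun i => pderiv i X u) k) Ω := by
  have h : ∀ i j, ContDiffOn ℝ ∞ (fun u => pderiv i X u j) Ω := fun i j =>
    contDiffOn_coord (contDiffOn_pderiv hΩ hX i) j
  unfold crossCovector
  simp only [Matrix.det_fin_three, Matrix.of_apply]
  fun_prop

/-- `n` consists of the frame components of a smooth unit normal along `X`, on `Ω`. -/
structure IsUnitNormalOn (Ω : Set (EuclideanSpace ℝ (Fin 3)))
    (X : EuclideanSpace ℝ (Fin 3) → Sol40) (n : EuclideanSpace ℝ (Fin 3) → Fin 4 → ℝ) : Prop where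
  contDiffOn : ContDiffOn ℝ ∞ n Ω
  unit : ∀ u ∈ Ω, ∑ k, n u k * n u k = 1
  normal : ∀ u ∈ Ω, ∀ w, ∑ k, n u k * solFrame (X u 3) (fderiv ℝ X u w) k = 0

theorem exists_isUnitNormalOn (hΩ : IsOpen Ω) (hX : ContDiffOn ℝ ∞ X Ω)
    (hinj : ∀ u ∈ Ω, Function.Injective (fderiv ℝ X u)) : ∃ n, IsUnitNormalOn Ω X n := by
  set ν : EuclideanSpace ℝ (Fin 3) → Fin 4 → ℝ := fun u => crossCovector fun i => pderiv i X u
  -- Components of the cross product covector in the orthonormal coframe, where the metric length is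
  -- the Euclidean one and normalization is division by a square root.
  set m : EuclideanSpace ℝ (Fin 3) → Fin 4 → ℝ := fun u => solCoframe (-(X u 3)) (ν u) with hm
  have hν : ∀ k, ContDiffOn ℝ ∞ (fun u => ν u k) Ω := contDiffOn_crossCovector hΩ hX
  have ht := contDiffOn_coord hX 3
  have hmsm : ∀ k, ContDiffOn ℝ ∞ (fun u => m u k) Ω := by
    intro k
    fin_cases k
    · simpa [hm, solCoframe] using ht.exp.mul (hν 0)
    · simpa [hm, solCoframe] using ht.exp.mul (hν 1)
    · simpa [hm, solCoframe] using (contDiffOn_const.mul ht).neg.exp.mul (hν 2)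
    · simpa [hm, solCoframe] using hν 3
  have hm0 : ∀ u ∈ Ω, m u ≠ 0 := fun u hu =>
    solCoframe_ne_zero _ (crossCovector_ne_zero (hinj u hu))
  have hpos : ∀ u ∈ Ω, 0 < ∑ k, m u k * m u k := by
    intro u hu
    refine lt_of_le_of_ne (Finset.sum_nonneg fun k _ => mul_self_nonneg _) fun h => hm0 u hu ?_
    funext k
    exact mul_self_eq_zero.1 ((Finset.sum_eq_zero_iff_of_nonneg
      (fun k _ => mul_self_nonneg (m u k))).1 h.symm k (Finset.mem_univ k))
  have hS : ContDiffOn ℝ ∞ (fun u => ∑ k, m u k * m u k) Ω :=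
    ContDiffOn.sum fun k _ => (hmsm k).mul (hmsm k)
  refine ⟨fun u k => m u k / Real.sqrt (∑ k, m u k * m u k), ?_, ?_, ?_⟩
  · rw [contDiffOn_pi]
    intro k
    exact (hmsm k).div (hS.sqrt fun u hu => (hpos u hu).ne')
      fun u hu => (Real.sqrt_pos.2 (hpos u hu)).ne'
  · intro u hu
    have h := hpos u hu
    simp only [div_mul_div_comm, ← Finset.sum_div, Real.mul_self_sqrt h.le]
    exact div_self h.ne'
  · intro u hu w
    simp only [div_mul_eq_mul_div, ← Finset.sum_div]
    rw [← sum_solCoframe_mul, hm]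
    simp only [solCoframe_neg_solCoframe]
    have : ∑ k, ν u k * fderiv ℝ X u w k = 0 := by
      have hexp : ∀ k, fderiv ℝ X u w k = ∑ i, w i * pderiv i X u k := by
        intro k; rw [fderiv_apply_eq_sum_pderiv]; simp
      simp only [hexp, Finset.mul_sum]
      rw [Finset.sum_comm]
      refine Finset.sum_eq_zero fun i _ => ?_
      have := sum_crossCovector_mul_self (fun i => pderiv i X u) i
      simp only [mul_left_comm _ (w i), ← Finset.mul_sum]
      rw [this, mul_zero]
    rw [this, zero_div]

/-- The derivative of the frame components of the unit normal of an umbilical hypersurface with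
principal curvature `l`. The arguments are the normal and a tangent vector, in the frame. -/
def weingartenForm (l : ℝ) (n θ : Fin 4 → ℝ) : Fin 4 → ℝ :=
  ![(n 3 - l) * θ 0, (n 3 - l) * θ 1, -(l + 2 * n 3) * θ 2, (n 3 - l) * θ 3 + 3 * n 2 * θ 2]

theorem solFrame_injective (t : ℝ) : Function.Injective (solFrame t) := by
  intro v w h
  have h0 := congrFun h 0
  have h1 := congrFun h 1
  have h2 := congrFun h 2
  have h3 := congrFun h 3
  simp [solFrame] at h0 h1 h2 h3
  ext k
  fin_cases k <;> assumption

/-- `solFrame` as a linear map. -/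
def solFrameMap (t : ℝ) : Sol40 →ₗ[ℝ] (Fin 4 → ℝ) where
  toFun := solFrame t
  map_add' v w := by funext k; fin_cases k <;> simp [solFrame, mul_add]
  map_smul' c v := by
    funext k; fin_cases k <;> simp [solFrame] <;> ring

theorem IsUnitNormalOn.ne_zero {n : EuclideanSpace ℝ (Fin 3) → Fin 4 → ℝ}
    (hn : IsUnitNormalOn Ω X n) {u : EuclideanSpace ℝ (Fin 3)} (hu : u ∈ Ω) : n u ≠ 0 := by
  intro h
  have := hn.unit u hu
  simp [h] at this

theorem IsUnitNormalOn.exists_frame_eq {n : EuclideanSpace ℝ (Fin 3) → Fin 4 → ℝ}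
    (hn : IsUnitNormalOn Ω X n) {u : EuclideanSpace ℝ (Fin 3)} (hu : u ∈ Ω)
    (hinj : Function.Injective (fderiv ℝ X u)) {y : Fin 4 → ℝ} (hy : ∑ k, n u k * y k = 0) :
    ∃ w, solFrame (X u 3) (fderiv ℝ X u w) = y :=
  exists_eq_of_annihilator (L := solFrameMap (X u 3) ∘ₗ (fderiv ℝ X u).toLinearMap)
    ((solFrame_injective _).comp hinj) (hn.ne_zero hu) (hn.normal u hu) hy

theorem hasFDerivAt_solCoframe {n : EuclideanSpace ℝ (Fin 3) → Fin 4 → ℝ}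
    {u : EuclideanSpace ℝ (Fin 3)} (hX : DifferentiableAt ℝ X u) (hn : DifferentiableAt ℝ n u) :
    DifferentiableAt ℝ (fun u => solCoframe (X u 3) (n u)) u ∧
    ∀ w, fderiv ℝ (fun u => solCoframe (X u 3) (n u)) u w =
      solCoframe (X u 3) (fderiv ℝ n u w) +
      fderiv ℝ X u w 3 • ![-Real.exp (-X u 3) * n u 0, -Real.exp (-X u 3) * n u 1,
        2 * Real.exp (2 * X u 3) * n u 2, 0] := by
  have hnk : ∀ k, HasFDerivAt (fun u => n u k)
      ((ContinuousLinearMap.proj k : (Fin 4 → ℝ) →L[ℝ] ℝ).comp (fderiv ℝ n u)) u := fun k =>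
    (ContinuousLinearMap.proj k : (Fin 4 → ℝ) →L[ℝ] ℝ).hasFDerivAt.comp u hn.hasFDerivAt
  have ht : HasFDerivAt (fun u => X u 3)
      ((EuclideanSpace.proj 3 : Sol40 →L[ℝ] ℝ).comp (fderiv ℝ X u)) u :=
    (EuclideanSpace.proj 3 : Sol40 →L[ℝ] ℝ).hasFDerivAt.comp u hX.hasFDerivAt
  have h0 := ht.neg.exp.mul (hnk 0)
  have h1 := ht.neg.exp.mul (hnk 1)
  have h2 := (ht.const_mul 2).exp.mul (hnk 2)
  have h3 := hnk 3
  have hd : DifferentiableAt ℝ (fun u => solCoframe (X u 3) (n u)) u := by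
    rw [differentiableAt_pi]
    intro k
    fin_cases k
    · exact h0.differentiableAt
    · exact h1.differentiableAt
    · exact h2.differentiableAt
    · exact h3.differentiableAt
  refine ⟨hd, fun w => ?_⟩
  funext k
  rw [fderiv_pi (fun k => differentiableAt_pi.1 hd k)]
  rw [ContinuousLinearMap.coe_pi']
  fin_cases k
  · refine (congrArg (fun T : EuclideanSpace ℝ (Fin 3) →L[ℝ] ℝ => T w) h0.fderiv).trans ?_
    simp [solCoframe]; ring
  · refine (congrArg (fun T : EuclideanSpace ℝ (Fin 3) →L[ℝ] ℝ => T w) h1.fderiv).trans ?_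
    simp [solCoframe]; ring
  · refine (congrArg (fun T : EuclideanSpace ℝ (Fin 3) →L[ℝ] ℝ => T w) h2.fderiv).trans ?_
    simp [solCoframe]; ring
  · refine (congrArg (fun T : EuclideanSpace ℝ (Fin 3) →L[ℝ] ℝ => T w) h3.fderiv).trans ?_
    simp [solCoframe]

end

/-! ### Weingarten equations of umbilical hypersurfaces -/

section

variable {Ω : Set (EuclideanSpace ℝ (Fin 3))} {X : EuclideanSpace ℝ (Fin 3) → Sol40}
  {n : EuclideanSpace ℝ (Fin 3) → Fin 4 → ℝ} {u : EuclideanSpace ℝ (Fin 3)}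

/-- The condition `h = g H` at the point with coordinates `u`. -/
def UmbilicalAt (X : EuclideanSpace ℝ (Fin 3) → Sol40) (u : EuclideanSpace ℝ (Fin 3)) : Prop :=
  ∀ i j : Fin 3, secondFundamentalForm solMetric X i j u =
    inducedMetric solMetric X u i j • meanCurvatureVector solMetric X u

theorem IsUnitNormalOn.differentiableAt (hΩ : IsOpen Ω) (hn : IsUnitNormalOn Ω X n)
    (hu : u ∈ Ω) : DifferentiableAt ℝ n u :=
  (hn.contDiffOn.contDiffAt (hΩ.mem_nhds hu)).differentiableAt (by simp)

theorem hasFDerivAt_comp_apply (hn : DifferentiableAt ℝ n u) (k : Fin 4) :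
    HasFDerivAt (fun u => n u k)
      ((ContinuousLinearMap.proj k : (Fin 4 → ℝ) →L[ℝ] ℝ).comp (fderiv ℝ n u)) u :=
  (ContinuousLinearMap.proj k : (Fin 4 → ℝ) →L[ℝ] ℝ).hasFDerivAt.comp u hn.hasFDerivAt

theorem IsUnitNormalOn.sum_mul_fderiv (hΩ : IsOpen Ω) (hn : IsUnitNormalOn Ω X n) (hu : u ∈ Ω)
    (w : EuclideanSpace ℝ (Fin 3)) : ∑ k, n u k * fderiv ℝ n u w k = 0 := by
  have hd := hn.differentiableAt hΩ hu
  have h1 := HasFDerivAt.fun_sum (u := Finset.univ) fun k _ =>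
    (hasFDerivAt_comp_apply hd k).mul (hasFDerivAt_comp_apply hd k)
  have h2 : (fun u' => ∑ k, n u' k * n u' k) =ᶠ[nhds u] fun _ => 1 := by
    filter_upwards [hΩ.mem_nhds hu] with u' hu' using hn.unit u' hu'
  have h3 := h1.unique ((hasFDerivAt_const (1 : ℝ) u).congr_of_eventuallyEq h2)
  have h4 := congrArg (fun T : EuclideanSpace ℝ (Fin 3) →L[ℝ] ℝ => T w) h3
  simp only [_root_.sum_apply, _root_.add_apply, _root_.smul_apply, _root_.zero_apply,
    ContinuousLinearMap.comp_apply, ContinuousLinearMap.proj_apply, smul_eq_mul,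
    Finset.sum_add_distrib] at h4
  linarith

theorem exp_neg_mul_self (t : ℝ) : Real.exp (-t) * Real.exp (-t) = Real.exp (-2 * t) := by
  rw [← Real.exp_add]; ring_nf

theorem exp_two_mul_self (t : ℝ) : Real.exp (2 * t) * Real.exp (2 * t) = Real.exp (4 * t) := by
  rw [← Real.exp_add]; ring_nf

theorem bilin_solMetric_eq_sum_frame (p v w : Sol40) :
    bilin (solMetric p) v w = ∑ k, solFrame (p 3) v k * solFrame (p 3) w k := by
  rw [bilin_solMetric, Fin.sum_univ_four, ← exp_neg_mul_self, ← exp_two_mul_self]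
  simp [solFrame]; ring

theorem two_le_infty : (2 : WithTop ℕ∞) ≤ ∞ := WithTop.coe_le_coe.2 le_top

/-- The second fundamental form of a hypersurface, in terms of a unit normal. -/
theorem IsUnitNormalOn.sum_mul_covDeriv (hΩ : IsOpen Ω) (hX : ContDiffOn ℝ ∞ X Ω)
    (hn : IsUnitNormalOn Ω X n) (hu : u ∈ Ω) (l : ℝ) (i j : Fin 3) :
    ∑ k, solCoframe (X u 3) (n u) k * covDeriv solMetric X i j u k =
      l * inducedMetric solMetric X u i j -
      ∑ k, (pderiv i n u k - weingartenForm l (n u) (solFrame (X u 3) (pderiv i X u)) k) *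
        solFrame (X u 3) (pderiv j X u) k := by
  have hXd := hX.contDiffAt (hΩ.mem_nhds hu)
  have hco := hasFDerivAt_solCoframe (hXd.differentiableAt (by simp)) (hn.differentiableAt hΩ hu)
  rw [_root_.sum_mul_covDeriv (ν := fun u => solCoframe (X u 3) (n u))
    (hXd.of_le two_le_infty) hco.1]
  · have hp : pderiv i (fun u => solCoframe (X u 3) (n u)) u = _ := hco.2 _
    rw [hp]
    change _ = l * bilin _ _ _ - _
    rw [bilin_solMetric_eq_sum_frame]
    have hni := hn.normal u hu (EuclideanSpace.single i 1)
    change ∑ k, n u k * solFrame (X u 3) (pderiv i X u) k = 0 at hni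
    change -∑ k, (solCoframe (X u 3) (pderiv i n u) + pderiv i X u 3 • _) k * _ + _ = _
    simp only [Fin.sum_univ_four, solConn, ← exp_neg_mul_self, ← exp_two_mul_self] at hni ⊢
    simp [solFrame, solCoframe, weingartenForm] at hni ⊢
    -- Tangency of `∂ᵢX` trades `n₀θ₀ + n₁θ₁` for `-n₂θ₂ - n₃θ₃` in the `t`-component; this produces
    -- the last entry of `weingartenForm`.
    linear_combination -pderiv j X u 3 * hni
  · filter_upwards [hΩ.mem_nhds hu] with u' hu' w
    rw [sum_solCoframe_mul]; exact hn.normal u' hu' w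

/-- The Weingarten equations of an umbilical hypersurface with unit normal `n` and principal
curvature `l`. -/
structure IsUmbilicalWith (Ω : Set (EuclideanSpace ℝ (Fin 3)))
    (X : EuclideanSpace ℝ (Fin 3) → Sol40) (n : EuclideanSpace ℝ (Fin 3) → Fin 4 → ℝ)
    (l : EuclideanSpace ℝ (Fin 3) → ℝ) : Prop extends IsUnitNormalOn Ω X n where
  isOpen : IsOpen Ω
  contDiffOn_map : ContDiffOn ℝ ∞ X Ω
  injective : ∀ u ∈ Ω, Function.Injective (fderiv ℝ X u)
  weingarten : ∀ u ∈ Ω, ∀ w,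
    fderiv ℝ n u w = weingartenForm (l u) (n u) (solFrame (X u 3) (fderiv ℝ X u w))

theorem weingartenForm_add (l : ℝ) (n θ θ' : Fin 4 → ℝ) :
    weingartenForm l n (θ + θ') = weingartenForm l n θ + weingartenForm l n θ' := by
  funext k; fin_cases k <;> simp [weingartenForm] <;> ring

theorem weingartenForm_smul (l c : ℝ) (n θ : Fin 4 → ℝ) :
    weingartenForm l n (c • θ) = c • weingartenForm l n θ := by
  funext k; fin_cases k <;> simp [weingartenForm] <;> ring

/-- The left side is `(n₃ - l)` times the pairing of `n` with `θ`. The Weingarten form of a tangent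
vector is thus itself tangent, as the derivative of a unit normal must be. -/
theorem sum_mul_weingartenForm (l : ℝ) (n θ : Fin 4 → ℝ) (h : ∑ k, n k * θ k = 0) :
    ∑ k, n k * weingartenForm l n θ k = 0 := by
  simp only [Fin.sum_univ_four] at h ⊢
  simp [weingartenForm]
  linear_combination (n 3 - l) * h

theorem exists_isUmbilicalWith (hΩ : IsOpen Ω) (hX : ContDiffOn ℝ ∞ X Ω)
    (hinj : ∀ u ∈ Ω, Function.Injective (fderiv ℝ X u)) (humb : ∀ u ∈ Ω, UmbilicalAt X u) :
    ∃ n l, IsUmbilicalWith Ω X n l := by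
  obtain ⟨n, hn⟩ := exists_isUnitNormalOn hΩ hX hinj
  have hlex : ∀ u, ∃ l : ℝ, u ∈ Ω → ∀ i j, ∑ k, solCoframe (X u 3) (n u) k *
      covDeriv solMetric X i j u k = l * inducedMetric solMetric X u i j := by
    intro u
    by_cases hu : u ∈ Ω
    · obtain ⟨l, hl⟩ := (umbilical_iff_exists (hinj u hu) (ν := solCoframe (X u 3) (n u))
        (solCoframe_ne_zero _ (hn.ne_zero hu))
        (fun w => by rw [sum_solCoframe_mul]; exact hn.normal u hu w)).1 (humb u hu)
      exact ⟨l, fun _ => hl⟩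
    · exact ⟨0, fun h => absurd h hu⟩
  -- The principal curvature is chosen point by point, with the value `0` outside `Ω`; its
  -- regularity is a separate matter, settled in `IsUmbilicalWith.differentiableAt_curvature`.
  choose l hl using hlex
  refine ⟨n, l, hn, hΩ, hX, hinj, fun u hu => ?_⟩
  have hbasis : ∀ i : Fin 3, pderiv i n u =
      weingartenForm (l u) (n u) (solFrame (X u 3) (pderiv i X u)) := by
    intro i
    have hzero : ∀ j, ∑ k, (pderiv i n u k - weingartenForm (l u) (n u)
        (solFrame (X u 3) (pderiv i X u)) k) * solFrame (X u 3) (pderiv j X u) k = 0 := by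
      intro j
      have h1 := hn.sum_mul_covDeriv hΩ hX hu (l u) i j
      rw [hl u hu] at h1
      linarith
    -- The defect `y` of the Weingarten equation is orthogonal to `n`, hence tangent, and by `hzero`
    -- orthogonal to every tangent vector. So it is orthogonal to itself.
    set y : Fin 4 → ℝ := pderiv i n u -
      weingartenForm (l u) (n u) (solFrame (X u 3) (pderiv i X u)) with hy
    have hny : ∑ k, n u k * y k = 0 := by
      simp only [hy, Pi.sub_apply, mul_sub, Finset.sum_sub_distrib]
      have hz : ∑ k, n u k * solFrame (X u 3) (pderiv i X u) k = 0 := hn.normal u hu _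
      rw [sum_mul_weingartenForm _ _ _ hz]
      have := hn.sum_mul_fderiv hΩ hu (EuclideanSpace.single i 1)
      rw [sub_zero]; exact this
    obtain ⟨w, hw⟩ := hn.exists_frame_eq hu (hinj u hu) hny
    have hwk : ∀ k, y k = ∑ j, w j * solFrame (X u 3) (pderiv j X u) k := by
      intro k
      have h1 : solFrameMap (X u 3) (fderiv ℝ X u w) = y := hw
      rw [fderiv_apply_eq_sum_pderiv, map_sum] at h1
      rw [← h1, Finset.sum_apply]
      exact Finset.sum_congr rfl fun j _ => by rw [map_smul]; rfl
    have hyy : ∑ k, y k * y k = 0 := by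
      have : ∀ k, y k * y k = ∑ j, w j * (y k * solFrame (X u 3) (pderiv j X u) k) := by
        intro k
        nth_rewrite 2 [hwk k]
        rw [Finset.mul_sum]
        exact Finset.sum_congr rfl fun j _ => by ring
      simp only [this]
      rw [Finset.sum_comm]
      refine Finset.sum_eq_zero fun j _ => ?_
      rw [← Finset.mul_sum]
      have := hzero j
      simp only [← Pi.sub_apply, ← hy] at this
      rw [this, mul_zero]
    have hy0 : y = 0 := by
      funext k
      exact mul_self_eq_zero.1 ((Finset.sum_eq_zero_iff_of_nonneg
        (fun k _ => mul_self_nonneg (y k))).1 hyy k (Finset.mem_univ k))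
    exact sub_eq_zero.1 hy0
  intro w
  have h1 : ∀ v, weingartenForm (l u) (n u) (solFrameMap (X u 3) v) =
      weingartenForm (l u) (n u) (solFrame (X u 3) v) := fun _ => rfl
  let W : (Fin 4 → ℝ) →ₗ[ℝ] (Fin 4 → ℝ) :=
    { toFun := weingartenForm (l u) (n u)
      map_add' := weingartenForm_add _ _
      map_smul' := fun c θ => weingartenForm_smul _ c _ θ }
  change _ = W (solFrameMap (X u 3) _)
  rw [fderiv_apply_eq_sum_pderiv, fderiv_apply_eq_sum_pderiv, map_sum, map_sum]
  refine Finset.sum_congr rfl fun i _ => ?_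
  rw [map_smul, map_smul, hbasis]; rfl

/-- The principal curvature of an umbilical hypersurface is differentiable. -/
theorem IsUmbilicalWith.differentiableAt_curvature {l : EuclideanSpace ℝ (Fin 3) → ℝ}
    (h : IsUmbilicalWith Ω X n l) (hu : u ∈ Ω) : DifferentiableAt ℝ l u := by
  set θ : EuclideanSpace ℝ (Fin 3) → Fin 4 → ℝ :=
    fun u => solFrame (X u 3) (pderiv 0 X u) with hθ
  set d : EuclideanSpace ℝ (Fin 3) → Fin 4 → ℝ := fun u => pderiv 0 n u with hd
  have hθpos : ∀ u ∈ Ω, θ u 0 * θ u 0 + θ u 1 * θ u 1 + θ u 2 * θ u 2 + θ u 3 * θ u 3 ≠ 0 := by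
    intro u hu h0
    have hb : bilin (solMetric (X u)) (pderiv 0 X u) (pderiv 0 X u) = 0 := by
      rw [bilin_solMetric_eq_sum_frame, Fin.sum_univ_four]; exact h0
    have h1 := eq_zero_of_bilin_solMetric_self hb
    have h2 := h.injective u hu (h1.trans (map_zero (fderiv ℝ X u)).symm)
    simpa using congrArg (fun v : EuclideanSpace ℝ (Fin 3) => v 0) h2
  -- Pairing the Weingarten equation in the direction `∂₀X` with `θ` gives a linear equation for `l`
  -- whose leading coefficient is `-|θ|²`. Solving it expresses `l` through smooth functions.
  have heq : l =ᶠ[nhds u] fun u => (n u 3 * (θ u 0 * θ u 0 + θ u 1 * θ u 1 - 2 * (θ u 2 * θ u 2) +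
      θ u 3 * θ u 3) + 3 * n u 2 * θ u 2 * θ u 3 - (d u 0 * θ u 0 + d u 1 * θ u 1 + d u 2 * θ u 2
      + d u 3 * θ u 3)) /
      (θ u 0 * θ u 0 + θ u 1 * θ u 1 + θ u 2 * θ u 2 + θ u 3 * θ u 3) := by
    filter_upwards [h.isOpen.mem_nhds hu] with u' hu'
    have hw : d u' = weingartenForm (l u') (n u') (θ u') := h.weingarten u' hu' _
    rw [eq_div_iff (hθpos u' hu'), hw]
    simp [weingartenForm]
    ring
  have hnd := h.differentiableAt h.isOpen hu
  have hnk : ∀ k, DifferentiableAt ℝ (fun u => n u k) u :=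
    fun k => (hasFDerivAt_comp_apply hnd k).differentiableAt
  have hdd : DifferentiableAt ℝ d u :=
    (((h.contDiffOn.fderiv_of_isOpen (m := ∞) h.isOpen (by simp)).clm_apply
      contDiffOn_const).contDiffAt (h.isOpen.mem_nhds hu)).differentiableAt (by simp)
  have hdk : ∀ k, DifferentiableAt ℝ (fun u => d u k) u :=
    fun k => (hasFDerivAt_comp_apply hdd k).differentiableAt
  have hXk : ∀ k, DifferentiableAt ℝ (fun u => X u k) u := fun k =>
    ((contDiffOn_coord h.contDiffOn_map k).contDiffAt (h.isOpen.mem_nhds hu)).differentiableAt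
      (by simp)
  have hpk : ∀ k, DifferentiableAt ℝ (fun u => pderiv 0 X u k) u := fun k =>
    ((contDiffOn_coord (contDiffOn_pderiv h.isOpen h.contDiffOn_map 0) k).contDiffAt
      (h.isOpen.mem_nhds hu)).differentiableAt (by simp)
  have hθ0 : DifferentiableAt ℝ (fun u => θ u 0) u := (hXk 3).neg.exp.mul (hpk 0)
  have hθ1 : DifferentiableAt ℝ (fun u => θ u 1) u := (hXk 3).neg.exp.mul (hpk 1)
  have hθ2 : DifferentiableAt ℝ (fun u => θ u 2) u := ((hXk 3).const_mul 2).exp.mul (hpk 2)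
  have hθ3 : DifferentiableAt ℝ (fun u => θ u 3) u := hpk 3
  have hn2 := hnk 2
  have hn3 := hnk 3
  have hd0 := hdk 0
  have hd1 := hdk 1
  have hd2 := hdk 2
  have hd3 := hdk 3
  refine DifferentiableAt.congr_of_eventuallyEq ?_ heq
  have hpos := hθpos u hu
  clear_value θ d
  simp only [div_eq_mul_inv]
  exact DifferentiableAt.fun_mul (by fun_prop) (DifferentiableAt.fun_inv (by fun_prop) hpos)

/-- `d² = 0` for a one-form `c dx + b dy`. -/
theorem wedge_eq_of_fderiv_eq {E : Type*} [NormedAddCommGroup E] [NormedSpace ℝ E]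
    {f c x b y : E → ℝ} {u : E} (hf : ContDiffAt ℝ 2 f u) (hx : ContDiffAt ℝ 2 x u)
    (hy : ContDiffAt ℝ 2 y u) (hc : DifferentiableAt ℝ c u) (hb : DifferentiableAt ℝ b u)
    (h : ∀ᶠ u' in nhds u, fderiv ℝ f u' = c u' • fderiv ℝ x u' + b u' • fderiv ℝ y u')
    (v w : E) :
    fderiv ℝ c u v * fderiv ℝ x u w + fderiv ℝ b u v * fderiv ℝ y u w =
      fderiv ℝ c u w * fderiv ℝ x u v + fderiv ℝ b u w * fderiv ℝ y u v := by
  have hd : ∀ {g : E → ℝ}, ContDiffAt ℝ 2 g u → DifferentiableAt ℝ (fderiv ℝ g) u := fun hg =>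
    (hg.fderiv_right (m := 1) (by norm_num)).differentiableAt (by norm_num)
  have hs : ∀ {g : E → ℝ}, ContDiffAt ℝ 2 g u → fderiv ℝ (fderiv ℝ g) u v w =
      fderiv ℝ (fderiv ℝ g) u w v := fun hg => (hg.isSymmSndFDerivAt (by simp)) v w
  have h1 : HasFDerivAt (fderiv ℝ f) _ u :=
    ((hc.hasFDerivAt.smul (hd hx).hasFDerivAt).add
      (hb.hasFDerivAt.smul (hd hy).hasFDerivAt)).congr_of_eventuallyEq h
  have hv : ∀ v w, fderiv ℝ (fderiv ℝ f) u v w = c u * fderiv ℝ (fderiv ℝ x) u v w +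
      fderiv ℝ c u v * fderiv ℝ x u w + (b u * fderiv ℝ (fderiv ℝ y) u v w +
      fderiv ℝ b u v * fderiv ℝ y u w) := by
    intro v w
    rw [h1.fderiv]
    simp
  have e := hs hf
  rw [hv, hv, hs hx, hs hy] at e
  linarith

end

section

variable {Ω : Set (EuclideanSpace ℝ (Fin 3))} {X : EuclideanSpace ℝ (Fin 3) → Sol40}
  {n : EuclideanSpace ℝ (Fin 3) → Fin 4 → ℝ} {u : EuclideanSpace ℝ (Fin 3)}
  {l : EuclideanSpace ℝ (Fin 3) → ℝ}

/-! ### Integrability conditions of the Weingarten equations -/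

theorem fderiv_comp_apply (hn : DifferentiableAt ℝ n u) (k : Fin 4)
    (w : EuclideanSpace ℝ (Fin 3)) : fderiv ℝ (fun u => n u k) u w = fderiv ℝ n u w k := by
  rw [(hasFDerivAt_comp_apply hn k).fderiv]; rfl

/-- The consequences of `d²n = 0` for an umbilical hypersurface. Here `θ v` are the frame components
of the tangent vector `v` and `dl` is the differential of the principal curvature. -/
theorem IsUmbilicalWith.integrability (h : IsUmbilicalWith Ω X n l) (hu : u ∈ Ω)
    {θ : EuclideanSpace ℝ (Fin 3) → Fin 4 → ℝ}
    (hθ : θ = fun v => solFrame (X u 3) (fderiv ℝ X u v))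
    {dl : EuclideanSpace ℝ (Fin 3) → ℝ} (hdl : dl = fun v => fderiv ℝ l u v)
    (v w : EuclideanSpace ℝ (Fin 3)) :
    ((3 * n u 2 * θ v 2 - dl v) * θ w 0 = (3 * n u 2 * θ w 2 - dl w) * θ v 0) ∧
    ((3 * n u 2 * θ v 2 - dl v) * θ w 1 = (3 * n u 2 * θ w 2 - dl w) * θ v 1) ∧
    ((dl v + 6 * n u 3 * θ v 3) * θ w 2 = (dl w + 6 * n u 3 * θ w 3) * θ v 2) ∧
    ((3 * n u 2 * θ v 2 - dl v) * θ w 3 + 6 * n u 2 * θ v 3 * θ w 2 =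
      (3 * n u 2 * θ w 2 - dl w) * θ v 3 + 6 * n u 2 * θ w 3 * θ v 2) := by
  have hnhds := h.isOpen.mem_nhds hu
  have hnC : ∀ k, ContDiffAt ℝ 2 (fun u => n u k) u := fun k =>
    ((contDiffOn_pi.1 h.contDiffOn k).contDiffAt hnhds).of_le two_le_infty
  have hXC : ∀ k, ContDiffAt ℝ 2 (fun u => X u k) u := fun k =>
    ((contDiffOn_coord h.contDiffOn_map k).contDiffAt hnhds).of_le two_le_infty
  have hnd : ∀ u ∈ Ω, DifferentiableAt ℝ n u := fun u hu => h.differentiableAt h.isOpen hu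
  have hXd : ∀ u ∈ Ω, DifferentiableAt ℝ X u := fun u hu =>
    (h.contDiffOn_map.contDiffAt (h.isOpen.mem_nhds hu)).differentiableAt (by simp)
  have hl := (h.differentiableAt_curvature hu).hasFDerivAt
  have hn2 := hasFDerivAt_comp_apply (hnd u hu) 2
  have hn3 := hasFDerivAt_comp_apply (hnd u hu) 3
  have ht : HasFDerivAt (fun u => X u 3)
      ((EuclideanSpace.proj 3 : Sol40 →L[ℝ] ℝ).comp (fderiv ℝ X u)) u :=
    (EuclideanSpace.proj 3 : Sol40 →L[ℝ] ℝ).hasFDerivAt.comp u (hXd u hu).hasFDerivAt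
  -- Coefficients of the Weingarten system in coordinates: `dn₀ = c0 dx`, `dn₁ = c0 dy`, `dn₂ = c2
  -- dz`, `dn₃ = c3 dt + b3 dz`. The forms `dx, dy, dz, dt` are closed, so `d² = 0` differentiates
  -- only these coefficients. The zero coefficient pads the one-term equations to the shape of
  -- `wedge_eq_of_fderiv_eq`.
  have c0 := (hn3.sub hl).mul ht.neg.exp
  have c2 := (hl.add (hn3.const_mul 2)).neg.mul (ht.const_mul 2).exp
  have c3 := hn3.sub hl
  have b3 := (hn2.const_mul 3).mul (ht.const_mul 2).exp
  have zero : DifferentiableAt ℝ (fun _ : EuclideanSpace ℝ (Fin 3) => (0 : ℝ)) u :=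
    differentiableAt_const _
  have hev : ∀ k, ∀ᶠ u' in nhds u, ∀ w, fderiv ℝ (fun u => n u k) u' w =
      weingartenForm (l u') (n u') (solFrame (X u' 3) (fderiv ℝ X u' w)) k := by
    intro k
    filter_upwards [hnhds] with u' hu' w
    rw [fderiv_comp_apply (hnd u' hu'), h.weingarten u' hu']
  have w0 := wedge_eq_of_fderiv_eq (hnC 0) (hXC 0) (hXC 0) c0.differentiableAt zero (by
    filter_upwards [hnhds, hev 0] with u' hu' hev'
    ext1 w
    simp only [hev', _root_.add_apply, _root_.smul_apply, fderiv_coord (hXd u' hu')]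
    simp [weingartenForm, solFrame]; ring) v w
  have w1 := wedge_eq_of_fderiv_eq (hnC 1) (hXC 1) (hXC 1) c0.differentiableAt zero (by
    filter_upwards [hnhds, hev 1] with u' hu' hev'
    ext1 w
    simp only [hev', _root_.add_apply, _root_.smul_apply, fderiv_coord (hXd u' hu')]
    simp [weingartenForm, solFrame]; ring) v w
  have w2 := wedge_eq_of_fderiv_eq (hnC 2) (hXC 2) (hXC 2) c2.differentiableAt zero (by
    filter_upwards [hnhds, hev 2] with u' hu' hev'
    ext1 w
    simp only [hev', _root_.add_apply, _root_.smul_apply, fderiv_coord (hXd u' hu')]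
    simp [weingartenForm, solFrame]; ring) v w
  have w3 := wedge_eq_of_fderiv_eq (hnC 3) (hXC 3) (hXC 2) c3.differentiableAt b3.differentiableAt
    (by
    filter_upwards [hnhds, hev 3] with u' hu' hev'
    ext1 w
    simp only [hev', _root_.add_apply, _root_.smul_apply, fderiv_coord (hXd u' hu')]
    simp [weingartenForm, solFrame]; ring) v w
  have e1 : Real.exp (-X u 3) ≠ 0 := (Real.exp_pos _).ne'
  have e2 : Real.exp (2 * X u 3) ≠ 0 := (Real.exp_pos _).ne'
  rw [c0.fderiv] at w0 w1
  rw [c2.fderiv] at w2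
  rw [c3.fderiv, b3.fderiv] at w3
  simp only [fderiv_coord (hXd u hu)] at w0 w1 w2 w3
  simp [h.weingarten u hu, weingartenForm, solFrame] at w0 w1 w2 w3
  subst hθ hdl
  simp [solFrame]
  refine ⟨?_, ?_, ?_, ?_⟩
  · linear_combination w0
  · linear_combination w1
  · linear_combination -w2
  · linear_combination w3

theorem IsUmbilicalWith.dichotomy (h : IsUmbilicalWith Ω X n l) (hu : u ∈ Ω) :
    (n u 0 = 0 ∧ n u 1 = 0) ∨ (n u 2 = 0 ∧ n u 3 = 0) := by
  by_contra! hcon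
  have hA : n u 0 * n u 0 + n u 1 * n u 1 ≠ 0 := fun h0 => by
    have h1 := mul_self_nonneg (n u 0)
    have h2 := mul_self_nonneg (n u 1)
    exact hcon.1 (mul_self_eq_zero.1 (by linarith)) (mul_self_eq_zero.1 (by linarith))
  have hB : n u 2 * n u 2 + n u 3 * n u 3 ≠ 0 := fun h0 => by
    have h1 := mul_self_nonneg (n u 2)
    have h2 := mul_self_nonneg (n u 3)
    exact hcon.2 (mul_self_eq_zero.1 (by linarith)) (mul_self_eq_zero.1 (by linarith))
  set A := n u 0 * n u 0 + n u 1 * n u 1 with hAdef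
  set B := n u 2 * n u 2 + n u 3 * n u 3 with hBdef
  obtain ⟨θ, hθ⟩ : ∃ θ : EuclideanSpace ℝ (Fin 3) → Fin 4 → ℝ,
    θ = fun v => solFrame (X u 3) (fderiv ℝ X u v) := ⟨_, rfl⟩
  obtain ⟨dl, hdl⟩ : ∃ dl : EuclideanSpace ℝ (Fin 3) → ℝ, dl = fun v => fderiv ℝ l u v := ⟨_, rfl⟩
  have hint := h.integrability hu hθ hdl
  have hex : ∀ y : Fin 4 → ℝ, ∑ k, n u k * y k = 0 → ∃ v, θ v = y := fun y hy => by
    rw [hθ]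
    exact h.exists_frame_eq hu (h.injective u hu) hy
  -- Tangent vectors adapted to the coframe: `v1, v2` have first two components `(B, 0)` and `(0,
  -- B)`, while `v3, v4` have last two components `(A, 0)` and `(0, A)`. The other entries are
  -- dictated by orthogonality to `n`.
  obtain ⟨v1, hv1⟩ := hex ![B, 0, -n u 0 * n u 2, -n u 0 * n u 3] (by
    simp [Fin.sum_univ_four, hBdef]; ring)
  obtain ⟨v2, hv2⟩ := hex ![0, B, -n u 1 * n u 2, -n u 1 * n u 3] (by
    simp [Fin.sum_univ_four, hBdef]; ring)
  obtain ⟨v3, hv3⟩ := hex ![-n u 0 * n u 2, -n u 1 * n u 2, A, 0] (by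
    simp [Fin.sum_univ_four, hAdef]; ring)
  obtain ⟨v4, hv4⟩ := hex ![-n u 0 * n u 3, -n u 1 * n u 3, 0, A] (by
    simp [Fin.sum_univ_four, hAdef]; ring)
  -- The form `ω = 3 n₂ θ₂ - dl` satisfies `ω ∧ θ₀ = 0` and `ω ∧ θ₁ = 0`. The first gives `ω(v2) =
  -- 0` because `θ₀(v2) = 0`; the second then gives `ω = 0`.
  have a1 : 3 * n u 2 * θ v2 2 - dl v2 = 0 := by
    have h1 := (hint v2 v1).1
    have : θ v2 0 = 0 := by simp [hv2]
    have h' : θ v1 0 = B := by simp [hv1]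
    rw [this, h', mul_zero] at h1
    exact (mul_eq_zero.1 h1).resolve_right hB
  have a2 : ∀ w, 3 * n u 2 * θ w 2 - dl w = 0 := by
    intro w
    have h1 := (hint w v2).2.1
    have h' : θ v2 1 = B := by simp [hv2]
    rw [a1, h', zero_mul] at h1
    exact (mul_eq_zero.1 h1).resolve_right hB
  have h32 : θ v3 2 = A := by simp [hv3]
  have h33 : θ v3 3 = 0 := by simp [hv3]
  have h42 : θ v4 2 = 0 := by simp [hv4]
  have h43 : θ v4 3 = A := by simp [hv4]
  have d3 := a2 v3
  have d4 := a2 v4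
  have b1 := (hint v4 v3).2.2.1
  have b2 := (hint v4 v3).2.2.2
  rw [h32] at d3
  rw [h42] at d4
  rw [h32, h33, h42, h43] at b1 b2
  -- With `dl = 3 n₂ θ₂` the last two relations reduce to `n₃ θ₃ ∧ θ₂ = 0` and `n₂ θ₃ ∧ θ₂ = 0`, and
  -- `(θ₃ ∧ θ₂)(v4, v3) = A²`.
  have hAA : A * A ≠ 0 := mul_ne_zero hA hA
  have n3 : n u 3 = 0 := by
    have : n u 3 * (A * A) = 0 := by linear_combination (1 / 6) * b1 + (1 / 6) * d4 * A
    exact (mul_eq_zero.1 this).resolve_right hAA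
  have n2 : n u 2 = 0 := by
    have : n u 2 * (A * A) = 0 := by linear_combination (1 / 6) * b2 + (1 / 6) * d3 * A
    exact (mul_eq_zero.1 this).resolve_right hAA
  exact hcon.2 n2 n3

/-- If the normal of an umbilical hypersurface has vanishing `∂z`- and `∂t`-components, then the
principal curvature is zero. -/
theorem IsUmbilicalWith.curvature_eq_zero (h : IsUmbilicalWith Ω X n l)
    (hn : ∀ u ∈ Ω, n u 2 = 0 ∧ n u 3 = 0) (hu : u ∈ Ω) : l u = 0 := by
  -- The unit vector `e^{-2t} ∂z` is tangent. Along it the Weingarten equation reads `dn₂ = -l`,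
  -- while `n₂` vanishes identically.
  obtain ⟨v, hv⟩ := h.exists_frame_eq hu (h.injective u hu) (y := ![0, 0, 1, 0]) (by
    simp [Fin.sum_univ_four, (hn u hu).1])
  have h1 := congrFun (h.weingarten u hu v) 2
  rw [hv, ← fderiv_comp_apply (h.differentiableAt h.isOpen hu)] at h1
  have h2 : (fun u => n u 2) =ᶠ[nhds u] fun _ => 0 := by
    filter_upwards [h.isOpen.mem_nhds hu] with u' hu' using (hn u' hu').1
  rw [h2.fderiv_eq] at h1
  simpa [weingartenForm, (hn u hu).2] using h1

/-- Under the same hypothesis, the normal has vanishing derivative in the frame. -/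
theorem IsUmbilicalWith.fderiv_normal_eq_zero (h : IsUmbilicalWith Ω X n l)
    (hn : ∀ u ∈ Ω, n u 2 = 0 ∧ n u 3 = 0) (hu : u ∈ Ω) : fderiv ℝ n u = 0 := by
  ext1 w
  rw [h.weingarten u hu, h.curvature_eq_zero hn hu]
  funext k
  fin_cases k <;> simp [weingartenForm, hn u hu]

end

/-! ### Charts of hypersurfaces -/

section Charts

variable {M : Type*} [TopologicalSpace M] [ChartedSpace (EuclideanSpace ℝ (Fin 3)) M]
  [IsManifold (𝓡 3) ∞ M] {F : M → Sol40}
  {e : OpenPartialHomeomorph M (EuclideanSpace ℝ (Fin 3))}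

theorem IsImmersedHypersurface.contDiffOn_chart (hF : IsImmersedHypersurface F)
    (he : e ∈ IsManifold.maximalAtlas (𝓡 3) ∞ M) : ContDiffOn ℝ ∞ (F ∘ e.symm) e.target := by
  rw [← contMDiffOn_iff_contDiffOn]
  exact hF.1.comp_contMDiffOn (contMDiffOn_symm_of_mem_maximalAtlas he)

theorem IsImmersedHypersurface.injective_fderiv_chart (hF : IsImmersedHypersurface F)
    (he : e ∈ IsManifold.maximalAtlas (𝓡 3) ∞ M) {u : EuclideanSpace ℝ (Fin 3)}
    (hu : u ∈ e.target) : Function.Injective (fderiv ℝ (F ∘ e.symm) u) := by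
  have hed : e.MDifferentiable (𝓡 3) (𝓡 3) :=
    ⟨(contMDiffOn_of_mem_maximalAtlas he).mdifferentiableOn (by simp),
      (contMDiffOn_symm_of_mem_maximalAtlas he).mdifferentiableOn (by simp)⟩
  have hFd : MDifferentiableAt (𝓡 3) (𝓡 4) F (e.symm u) := hF.1.mdifferentiableAt (by simp)
  have h1 : mfderiv (𝓡 3) (𝓡 4) (F ∘ e.symm) u = _ :=
    mfderiv_comp u hFd (hed.mdifferentiableAt_symm hu)
  rw [← mfderiv_eq_fderiv, h1]
  exact (hF.2 _).comp (hed.symm.mfderiv_injective (x := u) hu)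

theorem exists_continuousLinearEquiv_of_injective {E : Type*} [NormedAddCommGroup E]
    [NormedSpace ℝ E] [FiniteDimensional ℝ E] (T : E →L[ℝ] E) (hT : Function.Injective T) :
    ∃ T' : E ≃L[ℝ] E, (T' : E →L[ℝ] E) = T :=
  ⟨(LinearEquiv.ofInjectiveEndo T.toLinearMap hT).toContinuousLinearEquiv, by ext; rfl⟩

/-- Three linear coordinates of the ambient space that restrict to an isomorphism on a tangent
space of the hypersurface provide a chart. -/
theorem IsImmersedHypersurface.exists_chart (hF : IsImmersedHypersurface F) (p : M)
    (L : Sol40 →L[ℝ] EuclideanSpace ℝ (Fin 3))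
    (hc : e ∈ IsManifold.maximalAtlas (𝓡 3) ∞ M) (hp : p ∈ e.source)
    (hL : Function.Injective fun w => L (fderiv ℝ (F ∘ e.symm) (e p) w)) :
    ∃ e' ∈ IsManifold.maximalAtlas (𝓡 3) ∞ M, p ∈ e'.source ∧ (∀ q ∈ e'.source, e' q = L (F q)) ∧
      ∃ r > 0, e'.target = Metric.ball (L (F p)) r := by
  set X := F ∘ e.symm with hX
  have hXC := hF.contDiffOn_chart hc
  set Y : EuclideanSpace ℝ (Fin 3) → EuclideanSpace ℝ (Fin 3) := fun u => L (X u) with hY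
  have hYC : ContDiffOn ℝ ∞ Y e.target := L.contDiff.comp_contDiffOn hXC
  have hYd : ∀ u ∈ e.target, HasFDerivAt Y (L.comp (fderiv ℝ X u)) u := fun u hu =>
    L.hasFDerivAt.comp u ((hXC.contDiffAt (e.open_target.mem_nhds hu)).differentiableAt
      (by simp)).hasFDerivAt
  have hu0 := e.map_source hp
  obtain ⟨T, hT⟩ := exists_continuousLinearEquiv_of_injective (L.comp (fderiv ℝ X (e p))) hL
  have hYC0 := hYC.contDiffAt (e.open_target.mem_nhds hu0)
  have hT' : HasFDerivAt Y (T : EuclideanSpace ℝ (Fin 3) →L[ℝ] EuclideanSpace ℝ (Fin 3)) (e p) := by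
    rw [hT]; exact hYd _ hu0
  set g := hYC0.toOpenPartialHomeomorph Y hT' (by simp) with hg
  have hgY : ∀ u, g u = Y u := fun u => rfl
  have hg0 : e p ∈ g.source := hYC0.mem_toOpenPartialHomeomorph_source hT' (by simp)
  set R : Set (EuclideanSpace ℝ (Fin 3) →L[ℝ] EuclideanSpace ℝ (Fin 3)) :=
    range ((↑) : (EuclideanSpace ℝ (Fin 3) ≃L[ℝ] EuclideanSpace ℝ (Fin 3)) → _) with hR
  have hRopen : IsOpen R := ContinuousLinearEquiv.isOpen
  -- The inverse function theorem gives a local homeomorphism near `e p`. Keeping only points where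
  -- the derivative is invertible makes its inverse smooth everywhere on the new target.
  set S : Set (EuclideanSpace ℝ (Fin 3)) := e.target ∩ fderiv ℝ Y ⁻¹' R with hS
  have hSopen : IsOpen S :=
    (hYC.continuousOn_fderiv_of_isOpen e.open_target (by simp)).isOpen_inter_preimage
      e.open_target hRopen
  have hS0 : e p ∈ S := ⟨hu0, T, hT'.fderiv.symm⟩
  set g1 := g.restrOpen S hSopen with hg1
  set f := e.trans g1 with hf
  have hfsource : ∀ q, q ∈ f.source ↔ q ∈ e.source ∧ e q ∈ g.source ∧ e q ∈ S := by
    intro q; simp [hf, hg1]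
  have hfY : ∀ q, f q = Y (e q) := fun q => rfl
  have hpf : p ∈ f.source := (hfsource p).2 ⟨hp, hg0, hS0⟩
  obtain ⟨r, hr, hball⟩ := Metric.isOpen_iff.1 f.open_target (f p) (f.map_source hpf)
  -- The target, not the source, is shrunk, to obtain a ball: its convexity lets functions be
  -- followed along segments later.
  set f' := (f.symm.restrOpen (Metric.ball (f p) r) Metric.isOpen_ball).symm with hf'
  have hf'Y : ∀ q, f' q = Y (e q) := fun q => rfl
  have hf't : f'.target = Metric.ball (f p) r := by
    simp only [hf', OpenPartialHomeomorph.symm_target, OpenPartialHomeomorph.restrOpen_source,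
      OpenPartialHomeomorph.symm_source]
    exact inter_eq_right.2 hball
  have hf's : ∀ q ∈ f'.source, q ∈ f.source := by
    intro q hq
    have h1 := f'.map_source hq
    rw [hf't] at h1
    have h2 := f'.left_inv hq
    have h3 : f'.symm (f' q) = f.symm (f' q) := rfl
    rw [h3] at h2
    rw [← h2]
    exact f.map_target (hball h1)
  have hf'F : ∀ q ∈ f'.source, f' q = L (F q) := by
    intro q hq
    rw [hf'Y]
    simp only [hY, hX, Function.comp]
    rw [e.left_inv ((hfsource q).1 (hf's q hq)).1]
  have hp' : p ∈ f'.source := by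
    have : f p ∈ f'.target := by rw [hf't]; exact Metric.mem_ball_self hr
    have h2 := f'.map_target this
    have h3 : f'.symm (f p) = f.symm (f p) := rfl
    rwa [h3, f.left_inv hpf] at h2
  have hfp : f p = L (F p) := hf'F p hp'
  have hatlas : f' ∈ IsManifold.maximalAtlas (𝓡 3) ∞ M := by
    rw [IsManifold.mem_maximalAtlas_iff_contMDiffOn]
    constructor
    · have : ContMDiff (𝓡 3) (𝓡 3) ∞ fun q => L (F q) := L.contDiff.contMDiff.comp hF.1
      exact this.contMDiffOn.congr hf'F
    · intro y hy
      apply ContMDiffAt.contMDiffWithinAt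
      rw [hf't] at hy
      have hyf := hball hy
      have hys := f.map_target hyf
      have hyg := (hfsource _).1 hys
      set v := e (f.symm y) with hv
      have hvy : Y v = y := f.right_inv hyf
      have hygt : y ∈ g.target := by
        rw [← hvy, ← hgY]; exact g.map_source hyg.2.1
      have hgsy : g.symm y = v := by rw [← hvy, ← hgY, g.left_inv hyg.2.1]
      obtain ⟨T', hT'⟩ := hyg.2.2.2
      have hsm : ContDiffAt ℝ ∞ g.symm y := by
        refine g.contDiffAt_symm hygt (f₀' := T') ?_ ?_
        · rw [hgsy, hT']
          exact (hYd v hyg.2.2.1).differentiableAt.hasFDerivAt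
        · rw [hgsy]; exact hYC.contDiffAt (e.open_target.mem_nhds hyg.2.2.1)
      have hes : ContMDiffAt (𝓡 3) (𝓡 3) ∞ e.symm (g.symm y) := by
        rw [hgsy]; exact contMDiffAt_symm_of_mem_maximalAtlas hc hyg.2.2.1
      exact hes.comp y hsm.contMDiffAt
  exact ⟨f', hatlas, hp', hf'F, r, hr, by rw [hf't, hfp]⟩

/-- The tangent space of the hypersurface at `p` meets the kernel of `L` trivially. -/
def IsTransverseAt (L : Sol40 →L[ℝ] EuclideanSpace ℝ (Fin 3)) (F : M → Sol40) (p : M) : Prop :=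
  Function.Injective fun w =>
    L (fderiv ℝ (F ∘ (chartAt (EuclideanSpace ℝ (Fin 3)) p).symm)
      (chartAt (EuclideanSpace ℝ (Fin 3)) p p) w)

theorem IsImmersedHypersurface.exists_chart_of_isTransverseAt (hF : IsImmersedHypersurface F)
    {p : M} {L : Sol40 →L[ℝ] EuclideanSpace ℝ (Fin 3)} (hL : IsTransverseAt L F p) :
    ∃ e' ∈ IsManifold.maximalAtlas (𝓡 3) ∞ M, p ∈ e'.source ∧ (∀ q ∈ e'.source, e' q = L (F q)) ∧
      ∃ r > 0, e'.target = Metric.ball (L (F p)) r :=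
  hF.exists_chart p L (IsManifold.chart_mem_maximalAtlas p) (mem_chart_source _ p) hL

/-- Near each point `L ∘ F` is a chart, so it is an open map. Since `L` is injective on `P`, the
image of `V` is cut out of `P` by the `L`-preimage of an open set. -/
theorem isOpenPieceOf_of_isTransverseAt (hF : IsImmersedHypersurface F)
    {L : Sol40 →L[ℝ] EuclideanSpace ℝ (Fin 3)} (hL : ∀ p, IsTransverseAt L F p) {P : Set Sol40}
    (hP : InjOn L P) (hFP : ∀ p, F p ∈ P) : IsOpenPieceOf F P := by
  have hopen : IsOpenMap fun q => L (F q) := by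
    rw [isOpenMap_iff_nhds_le]
    intro p
    obtain ⟨e', -, hp, he', -⟩ := hF.exists_chart_of_isTransverseAt (hL p)
    rw [← he' p hp, ← e'.map_nhds_eq hp]
    refine le_of_eq (Filter.map_congr ?_)
    filter_upwards [e'.open_source.mem_nhds hp] with q hq using he' q hq
  intro V hV
  refine ⟨L ⁻¹' ((fun q => L (F q)) '' V), (hopen V hV).preimage L.continuous, ?_⟩
  ext y
  constructor
  · rintro ⟨q, hq, rfl⟩
    exact ⟨⟨q, hq, rfl⟩, hFP q⟩
  · rintro ⟨⟨q, hq, hqy⟩, hy⟩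
    exact ⟨q, hq, hP (hFP q) hy hqy⟩

theorem OpenPartialHomeomorph.eq_comp_symm_of_eq {L : Sol40 →L[ℝ] EuclideanSpace ℝ (Fin 3)}
    (he : ∀ q ∈ e.source, e q = L (F q)) {u : EuclideanSpace ℝ (Fin 3)} (hu : u ∈ e.target) :
    L ((F ∘ e.symm) u) = u := by
  have := he _ (e.map_target hu)
  rw [e.right_inv hu] at this
  exact this.symm

/-- In a chart given by `L ∘ F` the parametrization is a section of `L`; this is the differentiated
identity. -/
theorem IsImmersedHypersurface.comp_fderiv_eq (hF : IsImmersedHypersurface F)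
    (hc : e ∈ IsManifold.maximalAtlas (𝓡 3) ∞ M) {L : Sol40 →L[ℝ] EuclideanSpace ℝ (Fin 3)}
    (he : ∀ q ∈ e.source, e q = L (F q)) {u : EuclideanSpace ℝ (Fin 3)} (hu : u ∈ e.target)
    (w : EuclideanSpace ℝ (Fin 3)) : L (fderiv ℝ (F ∘ e.symm) u w) = w := by
  have hd : DifferentiableAt ℝ (F ∘ e.symm) u :=
    ((hF.contDiffOn_chart hc).contDiffAt (e.open_target.mem_nhds hu)).differentiableAt (by simp)
  have h1 := L.hasFDerivAt.comp u hd.hasFDerivAt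
  have h2 : L ∘ (F ∘ e.symm) =ᶠ[nhds u] id := by
    filter_upwards [e.open_target.mem_nhds hu] with u' hu'
      using OpenPartialHomeomorph.eq_comp_symm_of_eq he hu'
  have h3 := h1.unique ((hasFDerivAt_id u).congr_of_eventuallyEq h2)
  exact congrArg (fun T : EuclideanSpace ℝ (Fin 3) →L[ℝ] EuclideanSpace ℝ (Fin 3) => T w) h3

end Charts

/-- The linear map with the components `f`. -/
def coordMap (f : Fin 3 → (Sol40 →L[ℝ] ℝ)) : Sol40 →L[ℝ] EuclideanSpace ℝ (Fin 3) :=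
  ((EuclideanSpace.equiv (Fin 3) ℝ).symm : (Fin 3 → ℝ) →L[ℝ] EuclideanSpace ℝ (Fin 3)).comp
    (ContinuousLinearMap.pi f)

theorem coordMap_apply (f : Fin 3 → (Sol40 →L[ℝ] ℝ)) (v : Sol40) (i : Fin 3) :
    coordMap f v i = f i v := rfl

/-! ### Locality of the curvature -/

section Locality

variable {n : ℕ} {G G' : EuclideanSpace ℝ (Fin n) → Matrix (Fin n) (Fin n) ℝ}
  {x : EuclideanSpace ℝ (Fin n)}

theorem christoffel_eq_of_eventuallyEq (h : G =ᶠ[nhds x] G') (k i j : Fin n) :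
    christoffel G k i j x = christoffel G' k i j x := by
  have hp : ∀ a b c, pderiv c (fun y => G y a b) x = pderiv c (fun y => G' y a b) x := by
    intro a b c
    have : (fun y => G y a b) =ᶠ[nhds x] fun y => G' y a b := by
      filter_upwards [h] with y hy
      rw [hy]
    unfold pderiv
    rw [this.fderiv_eq]
  unfold christoffel
  simp only [hp, h.eq_of_nhds]

theorem christoffel_eventuallyEq (h : G =ᶠ[nhds x] G') (k i j : Fin n) :
    christoffel G k i j =ᶠ[nhds x] christoffel G' k i j := by
  filter_upwards [h.eventuallyEq_nhds] with y hy using christoffel_eq_of_eventuallyEq hy k i j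

theorem riemann_eq_of_eventuallyEq (h : G =ᶠ[nhds x] G') (l k i j : Fin n) :
    riemann G l k i j x = riemann G' l k i j x := by
  unfold riemann pderiv
  simp only [(christoffel_eventuallyEq h _ _ _).fderiv_eq, christoffel_eq_of_eventuallyEq h]

/-- The induced metric of a vertical hyperplane agrees with the model metric only on the target of a
chart, so curvature has to be compared through germs. -/
theorem sectionalCurvature_eq_of_eventuallyEq (h : G =ᶠ[nhds x] G')
    (v w : EuclideanSpace ℝ (Fin n)) :
    sectionalCurvature G x v w = sectionalCurvature G' x v w := by
  unfold sectionalCurvature riemannApply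
  simp only [riemann_eq_of_eventuallyEq h, h.eq_of_nhds]

end Locality

/-! ### Vertical hyperplanes -/

theorem pderiv_const {n : ℕ} (i : Fin n) (c : ℝ) (x : EuclideanSpace ℝ (Fin n)) :
    pderiv i (fun _ => c) x = 0 := by
  simp [pderiv]

/-- For `f² dx₀² + g² dx₁² + dx₂²` with `f = e^{-x₂}`, `g = e^{2 x₂}`, the curvature of this plane
is `-(f'/f)(g'/g) = -(-1)·2`. -/
theorem sectionalCurvature_expMetric_zero_one (x : EuclideanSpace ℝ (Fin 3)) :
    sectionalCurvature (expMetric ![-2, 4, 0] 2) x (EuclideanSpace.single 0 1)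
      (EuclideanSpace.single 1 1) = 2 := by
  have h011 : christoffel (expMetric ![-2, 4, 0] 2) (0 : Fin 3) 1 1 = fun _ => 0 := by
    funext y; simp [christoffel_expMetric]
  have h001 : christoffel (expMetric ![-2, 4, 0] 2) (0 : Fin 3) 0 1 = fun _ => 0 := by
    funext y; simp [christoffel_expMetric]
  have hR : riemann (expMetric ![-2, 4, 0] 2) (0 : Fin 3) 1 0 1 x = 2 * Real.exp (4 * x 2) := by
    unfold riemann
    rw [h011, h001, pderiv_const, pderiv_const]
    simp [christoffel_expMetric]
    ring
  unfold sectionalCurvature riemannApply bilin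
  generalize riemann (expMetric ![-2, 4, 0] 2) = R at hR
  simp [expMetric, Matrix.diagonal, hR]
  field_simp

/-- Here the plane contains the direction `∂₂`, and the curvature is `-f''/f` with `f = e^{-x₂}`. -/
theorem sectionalCurvature_expMetric_zero_two (x : EuclideanSpace ℝ (Fin 3)) :
    sectionalCurvature (expMetric ![-2, 4, 0] 2) x (EuclideanSpace.single 0 1)
      (EuclideanSpace.single 2 1) = -1 := by
  have h022 : christoffel (expMetric ![-2, 4, 0] 2) (0 : Fin 3) 2 2 = fun _ => 0 := by
    funext y; simp [christoffel_expMetric]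
  have h002 : christoffel (expMetric ![-2, 4, 0] 2) (0 : Fin 3) 0 2 = fun _ => -1 := by
    funext y; simp [christoffel_expMetric]
  have hR : riemann (expMetric ![-2, 4, 0] 2) (0 : Fin 3) 2 0 2 x = -1 := by
    unfold riemann
    rw [h022, h002, pderiv_const, pderiv_const]
    simp [christoffel_expMetric]
  unfold sectionalCurvature riemannApply bilin
  generalize riemann (expMetric ![-2, 4, 0] 2) = R at hR
  simp [expMetric, Matrix.diagonal, hR]

/-- The conormal of the vertical hyperplanes with angle `α`. -/
def verticalConormal (α : ℝ) : Fin 4 → ℝ := ![Real.cos α, Real.sin α, 0, 0]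

theorem verticalConormal_ne_zero (α : ℝ) : verticalConormal α ≠ 0 := by
  intro h
  have h0 : Real.cos α = 0 := congrFun h 0
  have h1 : Real.sin α = 0 := congrFun h 1
  have := Real.cos_sq_add_sin_sq α
  rw [h0, h1] at this
  norm_num at this

/-- The coordinates `(-x sin α + y cos α, z, t)` of the vertical hyperplanes. -/
def verticalCoord (α : ℝ) : Sol40 →L[ℝ] EuclideanSpace ℝ (Fin 3) :=
  coordMap ![-Real.sin α • EuclideanSpace.proj 0 + Real.cos α • EuclideanSpace.proj 1,
    EuclideanSpace.proj 2, EuclideanSpace.proj 3]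

theorem verticalCoord_zero (α : ℝ) (v : Sol40) :
    verticalCoord α v 0 = -Real.sin α * v 0 + Real.cos α * v 1 := by
  simp [verticalCoord, coordMap_apply]

theorem verticalCoord_one (α : ℝ) (v : Sol40) : verticalCoord α v 1 = v 2 := by
  simp [verticalCoord, coordMap_apply]

theorem verticalCoord_two (α : ℝ) (v : Sol40) : verticalCoord α v 2 = v 3 := by
  simp [verticalCoord, coordMap_apply]

theorem sum_verticalConormal_mul (α : ℝ) (v : Sol40) :
    ∑ k, verticalConormal α k * v k = v 0 * Real.cos α + v 1 * Real.sin α := by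
  simp [verticalConormal, Fin.sum_univ_four]; ring

theorem injOn_verticalCoord (α c : ℝ) : InjOn (verticalCoord α) (verticalHyperplane α c) := by
  intro v hv w hw h
  have h0 := congrArg (fun z : EuclideanSpace ℝ (Fin 3) => z 0) h
  have h1 := congrArg (fun z : EuclideanSpace ℝ (Fin 3) => z 1) h
  have h2 := congrArg (fun z : EuclideanSpace ℝ (Fin 3) => z 2) h
  simp only [verticalCoord_zero, verticalCoord_one, verticalCoord_two] at h0 h1 h2
  have e := Real.cos_sq_add_sin_sq α
  have hv' : v 0 * Real.cos α + v 1 * Real.sin α = c := hv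
  have hw' : w 0 * Real.cos α + w 1 * Real.sin α = c := hw
  ext k
  fin_cases k
  · simp only [Fin.zero_eta]
    linear_combination (w 0 - v 0) * e + Real.cos α * (hv' - hw') - Real.sin α * h0
  · simp only [Fin.mk_one]
    linear_combination (w 1 - v 1) * e + Real.sin α * (hv' - hw') + Real.cos α * h0
  · exact h1
  · exact h2

section Hypersurface

variable {M : Type*} [TopologicalSpace M] [ChartedSpace (EuclideanSpace ℝ (Fin 3)) M]
  [IsManifold (𝓡 3) ∞ M] {F : M → Sol40} {α c : ℝ}
  {e : OpenPartialHomeomorph M (EuclideanSpace ℝ (Fin 3))}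

theorem fderiv_mem_vertical (hF : IsImmersedHypersurface F)
    (he : e ∈ IsManifold.maximalAtlas (𝓡 3) ∞ M) (hP : range F ⊆ verticalHyperplane α c)
    {u : EuclideanSpace ℝ (Fin 3)} (hu : u ∈ e.target) (w : EuclideanSpace ℝ (Fin 3)) :
    fderiv ℝ (F ∘ e.symm) u w 0 * Real.cos α + fderiv ℝ (F ∘ e.symm) u w 1 * Real.sin α = 0 := by
  have hd : DifferentiableAt ℝ (F ∘ e.symm) u :=
    ((hF.contDiffOn_chart he).contDiffAt (e.open_target.mem_nhds hu)).differentiableAt (by simp)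
  let f : Sol40 →L[ℝ] ℝ := Real.cos α • EuclideanSpace.proj 0 + Real.sin α • EuclideanSpace.proj 1
  have hf : ∀ v, f v = v 0 * Real.cos α + v 1 * Real.sin α := by
    intro v; simp [f]; ring
  have h1 := f.hasFDerivAt.comp u hd.hasFDerivAt
  have h2 : f ∘ (F ∘ e.symm) = fun _ => c := by
    funext u'
    rw [Function.comp_apply, hf]
    exact hP ⟨e.symm u', rfl⟩
  rw [h2] at h1
  have h3 := h1.unique (hasFDerivAt_const c u)
  have h4 := congrArg (fun T : EuclideanSpace ℝ (Fin 3) →L[ℝ] ℝ => T w) h3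
  simpa [hf] using h4

/-- The conormal `(cos α, sin α, 0, 0)` is constant, and its pairing with the connection term is a
combination of its pairings with the two tangent vectors, which vanish. -/
theorem isTotallyGeodesic_of_range_subset (hF : IsImmersedHypersurface F)
    (hP : range F ⊆ verticalHyperplane α c) : IsTotallyGeodesic F := by
  intro e he u hu i j
  have hν : ∀ u' ∈ e.target, ∀ w,
      ∑ k, verticalConormal α k * fderiv ℝ (F ∘ e.symm) u' w k = 0 := by
    intro u' hu' w
    rw [sum_verticalConormal_mul, fderiv_mem_vertical hF he hP hu']
  apply secondFundamentalForm_eq_zero (hF.injective_fderiv_chart he hu)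
    (verticalConormal_ne_zero α) (hν u hu)
  have h1 := sum_mul_covDeriv (ν := fun _ => verticalConormal α)
    (((hF.contDiffOn_chart he).contDiffAt (e.open_target.mem_nhds hu)).of_le two_le_infty)
    (differentiableAt_const _)
    (by filter_upwards [e.open_target.mem_nhds hu] with u' hu' using hν u' hu') i j
  rw [h1]
  have hi : pderiv i (F ∘ e.symm) u 0 * Real.cos α + pderiv i (F ∘ e.symm) u 1 * Real.sin α = 0 :=
    fderiv_mem_vertical hF he hP hu _
  have hj : pderiv j (F ∘ e.symm) u 0 * Real.cos α + pderiv j (F ∘ e.symm) u 1 * Real.sin α = 0 :=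
    fderiv_mem_vertical hF he hP hu _
  have hz : pderiv i (fun _ : EuclideanSpace ℝ (Fin 3) => verticalConormal α) u = 0 := by
    simp [pderiv]
  rw [hz]
  simp [solConn, verticalConormal]
  linear_combination -pderiv i (F ∘ e.symm) u 3 * hj - pderiv j (F ∘ e.symm) u 3 * hi

theorem IsTotallyGeodesic.isTotallyUmbilical (h : IsTotallyGeodesic F) : IsTotallyUmbilical F := by
  intro e he u hu i j
  simp [meanCurvatureVector, h e he u hu]

theorem isTransverseAt_verticalCoord (hF : IsImmersedHypersurface F)
    (hP : range F ⊆ verticalHyperplane α c) (p : M) : IsTransverseAt (verticalCoord α) F p := by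
  have hc := IsManifold.chart_mem_maximalAtlas (I := 𝓡 3) (n := ∞) p
  have hu := mem_chart_target (EuclideanSpace ℝ (Fin 3)) p
  intro v w hvw
  -- Tangent vectors lie in the parallel hyperplane through the origin, on which `verticalCoord` is
  -- injective.
  exact hF.injective_fderiv_chart hc hu (injOn_verticalCoord α 0
    (fderiv_mem_vertical hF hc hP hu v) (fderiv_mem_vertical hF hc hP hu w) hvw)

theorem not_hasConstantSectionalCurvature_of_range_subset [Nonempty M]
    (hF : IsImmersedHypersurface F) (hP : range F ⊆ verticalHyperplane α c) :
    ¬ HasConstantSectionalCurvature F := by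
  rintro ⟨κ, hκ⟩
  obtain ⟨p⟩ := ‹Nonempty M›
  obtain ⟨e, he, hp, heF, -⟩ :=
    hF.exists_chart_of_isTransverseAt (isTransverseAt_verticalCoord hF hP p)
  have hmet : ∀ u ∈ e.target,
      inducedMetric solMetric (F ∘ e.symm) u = expMetric ![-2, 4, 0] 2 u := by
    intro u hu
    have ht : (F ∘ e.symm) u 3 = u 2 := by
      rw [← verticalCoord_two α, OpenPartialHomeomorph.eq_comp_symm_of_eq heF hu]
    have hcomp : ∀ i : Fin 3, (pderiv i (F ∘ e.symm) u 0 * Real.cos α +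
        pderiv i (F ∘ e.symm) u 1 * Real.sin α = 0) ∧
        verticalCoord α (pderiv i (F ∘ e.symm) u) = EuclideanSpace.single i 1 := fun i =>
      ⟨fderiv_mem_vertical hF he hP hu _, hF.comp_fderiv_eq he heF hu _⟩
    -- On tangent vectors `cos α dx + sin α dy = 0`, so the rotation-invariant form `dx² + dy²`
    -- equals `(-sin α dx + cos α dy)²`.
    have hfr : ∀ i j : Fin 3, pderiv i (F ∘ e.symm) u 0 * pderiv j (F ∘ e.symm) u 0 +
        pderiv i (F ∘ e.symm) u 1 * pderiv j (F ∘ e.symm) u 1 =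
        (EuclideanSpace.single i (1 : ℝ) : EuclideanSpace ℝ (Fin 3)) 0 *
        (EuclideanSpace.single j (1 : ℝ) : EuclideanSpace ℝ (Fin 3)) 0 := by
      intro i j
      rw [← (hcomp i).2, ← (hcomp j).2, verticalCoord_zero, verticalCoord_zero]
      have e1 := Real.cos_sq_add_sin_sq α
      linear_combination (-(pderiv i (F ∘ e.symm) u 0 * pderiv j (F ∘ e.symm) u 0 +
        pderiv i (F ∘ e.symm) u 1 * pderiv j (F ∘ e.symm) u 1)) * e1 +
        (hcomp i).1 * (pderiv j (F ∘ e.symm) u 0 * Real.cos α +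
        pderiv j (F ∘ e.symm) u 1 * Real.sin α)
    have h2 : ∀ i : Fin 3, pderiv i (F ∘ e.symm) u 2 =
        (EuclideanSpace.single i (1 : ℝ) : EuclideanSpace ℝ (Fin 3)) 1 := by
      intro i; rw [← (hcomp i).2, verticalCoord_one]
    have h3 : ∀ i : Fin 3, pderiv i (F ∘ e.symm) u 3 =
        (EuclideanSpace.single i (1 : ℝ) : EuclideanSpace ℝ (Fin 3)) 2 := by
      intro i; rw [← (hcomp i).2, verticalCoord_two]
    ext i j
    change bilin _ _ _ = _
    rw [bilin_solMetric, hfr, h2, h2, h3, h3, ht]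
    fin_cases i <;> fin_cases j <;> simp [expMetric, Matrix.diagonal]
  have hu := e.map_source hp
  have hev : inducedMetric solMetric (F ∘ e.symm) =ᶠ[nhds (e p)] expMetric ![-2, 4, 0] 2 := by
    filter_upwards [e.open_target.mem_nhds hu] with u hu using hmet u hu
  have hind : ∀ j : Fin 3, j ≠ 0 → LinearIndependent ℝ
      ![(EuclideanSpace.single 0 1 : EuclideanSpace ℝ (Fin 3)), EuclideanSpace.single j 1] := by
    intro j hj
    rw [LinearIndependent.pair_iff]
    intro s t hst
    have h0 := congrArg (fun z : EuclideanSpace ℝ (Fin 3) => z 0) hst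
    have h1 := congrArg (fun z : EuclideanSpace ℝ (Fin 3) => z j) hst
    simp [hj, hj.symm] at h0 h1
    exact ⟨h0, h1⟩
  have k1 := hκ e he _ hu _ _ (hind 1 (by simp))
  have k2 := hκ e he _ hu _ _ (hind 2 (by simp))
  rw [sectionalCurvature_eq_of_eventuallyEq hev, sectionalCurvature_expMetric_zero_one] at k1
  rw [sectionalCurvature_eq_of_eventuallyEq hev, sectionalCurvature_expMetric_zero_two] at k2
  rw [← k2] at k1
  norm_num at k1

end Hypersurface

/-! ### Cylinders over curves -/

section Cylinder

variable {Ω : Set (EuclideanSpace ℝ (Fin 3))} {X : EuclideanSpace ℝ (Fin 3) → Sol40}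
  {u : EuclideanSpace ℝ (Fin 3)} {σ : EuclideanSpace ℝ (Fin 3) → ℝ} {J : Set ℝ} {γ₁ γ₂ : ℝ → ℝ}

/-- A conormal of a hypersurface on which `z` and `t` depend only on one parameter `s`. -/
def cylinderConormal (γ₁ γ₂ : ℝ → ℝ) (s : ℝ) : Fin 4 → ℝ := ![0, 0, -deriv γ₂ s, deriv γ₁ s]

/-- `X` is defined on the open set `Ω`, where its last two components are `γ₁ ∘ σ`, `γ₂ ∘ σ`. -/
structure IsCylindrical (Ω : Set (EuclideanSpace ℝ (Fin 3))) (X : EuclideanSpace ℝ (Fin 3) → Sol40)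
    (σ : EuclideanSpace ℝ (Fin 3) → ℝ) (J : Set ℝ) (γ₁ γ₂ : ℝ → ℝ) : Prop where
  isOpen : IsOpen Ω
  contDiffOn : ContDiffOn ℝ ∞ X Ω
  injective : ∀ u ∈ Ω, Function.Injective (fderiv ℝ X u)
  contDiffOn_param : ContDiffOn ℝ ∞ σ Ω
  mapsTo : MapsTo σ Ω J
  isOpen_interval : IsOpen J
  contDiffOn_fst : ContDiffOn ℝ ∞ γ₁ J
  contDiffOn_snd : ContDiffOn ℝ ∞ γ₂ J
  apply_two : ∀ u ∈ Ω, X u 2 = γ₁ (σ u)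
  apply_three : ∀ u ∈ Ω, X u 3 = γ₂ (σ u)

namespace IsCylindrical

theorem hasDerivAt {J : Set ℝ} {γ : ℝ → ℝ} (hJ : IsOpen J) (hγ : ContDiffOn ℝ ∞ γ J) {s : ℝ}
    (hs : s ∈ J) : HasDerivAt γ (deriv γ s) s ∧ HasDerivAt (deriv γ) (deriv (deriv γ) s) s :=
  ⟨((hγ.contDiffAt (hJ.mem_nhds hs)).differentiableAt (by simp)).hasDerivAt,
    (((hγ.deriv_of_isOpen hJ (m := ∞) (by simp)).contDiffAt (hJ.mem_nhds hs)).differentiableAt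
      (by simp)).hasDerivAt⟩

theorem hasFDerivAt_param (h : IsCylindrical Ω X σ J γ₁ γ₂) (hu : u ∈ Ω) :
    HasFDerivAt σ (fderiv ℝ σ u) u :=
  ((h.contDiffOn_param.contDiffAt (h.isOpen.mem_nhds hu)).differentiableAt (by simp)).hasFDerivAt

theorem fderiv_apply (h : IsCylindrical Ω X σ J γ₁ γ₂) (hu : u ∈ Ω)
    (w : EuclideanSpace ℝ (Fin 3)) :
    fderiv ℝ X u w 2 = deriv γ₁ (σ u) * fderiv ℝ σ u w ∧
    fderiv ℝ X u w 3 = deriv γ₂ (σ u) * fderiv ℝ σ u w := by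
  have hd : DifferentiableAt ℝ X u :=
    (h.contDiffOn.contDiffAt (h.isOpen.mem_nhds hu)).differentiableAt (by simp)
  have h1 : (fun u => X u 2) =ᶠ[nhds u] γ₁ ∘ σ := by
    filter_upwards [h.isOpen.mem_nhds hu] with u' hu' using h.apply_two u' hu'
  have h2 : (fun u => X u 3) =ᶠ[nhds u] γ₂ ∘ σ := by
    filter_upwards [h.isOpen.mem_nhds hu] with u' hu' using h.apply_three u' hu'
  have d1 := ((hasDerivAt h.isOpen_interval h.contDiffOn_fst (h.mapsTo hu)).1.comp_hasFDerivAt u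
    (h.hasFDerivAt_param hu)).fderiv
  have d2 := ((hasDerivAt h.isOpen_interval h.contDiffOn_snd (h.mapsTo hu)).1.comp_hasFDerivAt u
    (h.hasFDerivAt_param hu)).fderiv
  rw [← fderiv_coord hd, ← fderiv_coord hd, h1.fderiv_eq, h2.fderiv_eq, d1, d2]
  simp

theorem annihilator (h : IsCylindrical Ω X σ J γ₁ γ₂) (hu : u ∈ Ω)
    (w : EuclideanSpace ℝ (Fin 3)) :
    ∑ k, cylinderConormal γ₁ γ₂ (σ u) k * fderiv ℝ X u w k = 0 := by
  simp [cylinderConormal, Fin.sum_univ_four, h.fderiv_apply hu w]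
  ring

/-- If both derivatives vanished, `dz` and `dt` would vanish on the three-dimensional tangent space.
But `dz = 0` alone already makes that space contain `∂t`. -/
theorem conormal_ne_zero (h : IsCylindrical Ω X σ J γ₁ γ₂) (hu : u ∈ Ω) :
    cylinderConormal γ₁ γ₂ (σ u) ≠ 0 := by
  intro h0
  have h1 : -deriv γ₂ (σ u) = 0 := congrFun h0 2
  have h2 : deriv γ₁ (σ u) = 0 := congrFun h0 3
  have h3 : deriv γ₂ (σ u) = 0 := by linarith
  obtain ⟨w, hw⟩ := exists_eq_of_annihilator
    (L := (WithLp.linearEquiv 2 ℝ (Fin 4 → ℝ)).toLinearMap ∘ₗ (fderiv ℝ X u).toLinearMap)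
    ((WithLp.linearEquiv 2 ℝ (Fin 4 → ℝ)).injective.comp (h.injective u hu))
    (ν := ![0, 0, 1, 0]) (fun h => by simpa using congrFun h 2)
    (fun w => by
      have := (h.fderiv_apply hu w).1
      simp [Fin.sum_univ_four, this, h2]) (y := ![0, 0, 0, 1]) (by simp [Fin.sum_univ_four])
  have h4 : fderiv ℝ X u w 3 = 1 := congrFun hw 3
  rw [(h.fderiv_apply hu w).2, h3] at h4
  simp at h4

/-- The derivative of the conormal contributes `γ₁''` and `γ₂''`; completing the connection term to
`γ₁' g` leaves a multiple of `dσ ⊗ dσ`. An arbitrary parameter function `σ` is allowed because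
umbilicity must be tested in every chart, not only in one adapted to the curve. -/
theorem sum_mul_covDeriv (h : IsCylindrical Ω X σ J γ₁ γ₂) (hu : u ∈ Ω) (i j : Fin 3) :
    ∑ k, cylinderConormal γ₁ γ₂ (σ u) k * covDeriv solMetric X i j u k =
      deriv γ₁ (σ u) * inducedMetric solMetric X u i j -
      (deriv (deriv γ₁) (σ u) * deriv γ₂ (σ u) - deriv γ₁ (σ u) * deriv (deriv γ₂) (σ u)
        + 5 * deriv γ₁ (σ u) * deriv γ₂ (σ u) ^ 2
        + 3 * Real.exp (4 * γ₂ (σ u)) * deriv γ₁ (σ u) ^ 3) *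
        (pderiv i σ u * pderiv j σ u) := by
  have h1 := (hasDerivAt h.isOpen_interval h.contDiffOn_fst (h.mapsTo hu)).2.comp_hasFDerivAt u
    (h.hasFDerivAt_param hu)
  have h2 := ((hasDerivAt h.isOpen_interval h.contDiffOn_snd
    (h.mapsTo hu)).2.comp_hasFDerivAt u (h.hasFDerivAt_param hu)).neg
  have hz := hasFDerivAt_const (𝕜 := ℝ) (0 : ℝ) u
  have hν : HasFDerivAt (fun u => cylinderConormal γ₁ γ₂ (σ u)) (ContinuousLinearMap.pi
      ![0, 0, -(deriv (deriv γ₂) (σ u) • fderiv ℝ σ u), deriv (deriv γ₁) (σ u) • fderiv ℝ σ u])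
      u := by
    rw [hasFDerivAt_pi']
    intro k
    fin_cases k
    · exact hz
    · exact hz
    · exact h2
    · exact h1
  rw [_root_.sum_mul_covDeriv (ν := fun u => cylinderConormal γ₁ γ₂ (σ u))
    ((h.contDiffOn.contDiffAt (h.isOpen.mem_nhds hu)).of_le two_le_infty) hν.differentiableAt
    (by filter_upwards [h.isOpen.mem_nhds hu] with u' hu' using h.annihilator hu')]
  have hp : pderiv i (fun u => cylinderConormal γ₁ γ₂ (σ u)) u =
      ![0, 0, -(deriv (deriv γ₂) (σ u) * pderiv i σ u), deriv (deriv γ₁) (σ u) * pderiv i σ u] := by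
    unfold pderiv
    rw [hν.fderiv]
    funext k
    fin_cases k <;> simp
  have hi2 : pderiv i X u 2 = deriv γ₁ (σ u) * pderiv i σ u := (h.fderiv_apply hu _).1
  have hi3 : pderiv i X u 3 = deriv γ₂ (σ u) * pderiv i σ u := (h.fderiv_apply hu _).2
  have hj2 : pderiv j X u 2 = deriv γ₁ (σ u) * pderiv j σ u := (h.fderiv_apply hu _).1
  have hj3 : pderiv j X u 3 = deriv γ₂ (σ u) * pderiv j σ u := (h.fderiv_apply hu _).2
  rw [hp]
  change _ = _ * bilin _ _ _ - _
  rw [bilin_solMetric]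
  simp only [solConn, Fin.sum_univ_four, hi2, hi3, hj2, hj3, h.apply_three u hu]
  simp [cylinderConormal]
  ring

end IsCylindrical

end Cylinder

/-! ### Profile equation implies umbilicity -/

section Hypersurface

variable {M : Type*} [TopologicalSpace M] [ChartedSpace (EuclideanSpace ℝ (Fin 3)) M]
  [IsManifold (𝓡 3) ∞ M] {F : M → Sol40}

theorem isTotallyUmbilical_of_isCylinderOverProfileCurve (hF : IsImmersedHypersurface F)
    {a : Sol40} (h : IsCylinderOverProfileCurve fun p => solMul a (F p)) :
    IsTotallyUmbilical F := by
  intro e he u hu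
  obtain ⟨e₀, he₀, hp, J, γ₁, γ₂, hJ, -, hγ₁, hγ₂, hode, hform⟩ := h (e.symm u)
  set X := F ∘ e.symm with hX
  set Ω := e.target ∩ e.symm ⁻¹' e₀.source with hΩ
  set σ : EuclideanSpace ℝ (Fin 3) → ℝ := fun u => e₀ (e.symm u) 2 with hσ
  have hΩo : IsOpen Ω := e.symm.isOpen_inter_preimage e₀.open_source
  have hσs : ContDiffOn ℝ ∞ (fun u => e₀ (e.symm u)) Ω := by
    rw [← contMDiffOn_iff_contDiffOn]
    exact (contMDiffOn_of_mem_maximalAtlas he₀).comp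
      ((contMDiffOn_symm_of_mem_maximalAtlas he).mono inter_subset_left) fun u hu => hu.2
  have hval : ∀ u ∈ Ω, σ u ∈ J ∧ a 2 + Real.exp (-2 * a 3) * X u 2 = γ₁ (σ u) ∧
      a 3 + X u 3 = γ₂ (σ u) := by
    intro u hu
    obtain ⟨h1, h2⟩ := hform _ (e₀.map_source hu.2)
    rw [e₀.left_inv hu.2] at h2
    refine ⟨h1, ?_, ?_⟩
    · simpa [solMul, hX, hσ] using congrArg (fun v : Sol40 => v 2) h2
    · simpa [solMul, hX, hσ] using congrArg (fun v : Sol40 => v 3) h2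
  have hexp : Real.exp (2 * a 3) * Real.exp (-2 * a 3) = 1 := by
    rw [← Real.exp_add]; ring_nf; simp
  -- Undoing the left translation moves the profile curve to `(e^{2 a₃}(γ₁ - a₂), γ₂ - a₃)`. The
  -- left side of the profile equation is only multiplied by `e^{2 a₃}`, so no invariance of the
  -- second fundamental form under translations is needed.
  have hcyl : IsCylindrical Ω X σ J (fun s => Real.exp (2 * a 3) * (γ₁ s - a 2))
      (fun s => γ₂ s - a 3) :=
    { isOpen := hΩo
      contDiffOn := (hF.contDiffOn_chart he).mono inter_subset_left
      injective := fun u hu => hF.injective_fderiv_chart he hu.1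
      contDiffOn_param := contDiffOn_coord hσs 2
      mapsTo := fun u hu => (hval u hu).1
      isOpen_interval := hJ
      contDiffOn_fst := contDiffOn_const.mul (hγ₁.sub contDiffOn_const)
      contDiffOn_snd := hγ₂.sub contDiffOn_const
      apply_two := fun u hu => by
        have := (hval u hu).2.1
        linear_combination (-X u 2) * hexp + Real.exp (2 * a 3) * this
      apply_three := fun u hu => by linarith [(hval u hu).2.2] }
  have hu' : u ∈ Ω := ⟨hu, hp⟩
  have d1 : deriv (fun s => Real.exp (2 * a 3) * (γ₁ s - a 2)) =
      fun s => Real.exp (2 * a 3) * deriv γ₁ s := by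
    funext s; simp
  have d2 : deriv (fun s => γ₂ s - a 3) = deriv γ₂ := by
    funext s; simp
  apply (umbilical_iff_exists (hcyl.injective u hu') (hcyl.conormal_ne_zero hu')
    (hcyl.annihilator hu')).2
  refine ⟨deriv (fun s => Real.exp (2 * a 3) * (γ₁ s - a 2)) (σ u), fun i j => ?_⟩
  rw [hcyl.sum_mul_covDeriv hu' i j, sub_eq_self, d1, d2]
  have e1 : Real.exp (4 * (γ₂ (σ u) - a 3)) * (Real.exp (2 * a 3) * Real.exp (2 * a 3)) =
      Real.exp (4 * γ₂ (σ u)) := by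
    rw [← Real.exp_add, ← Real.exp_add]; ring_nf
  have hode' := hode (σ u) (hval u hu').1
  have d3 : deriv (fun s => Real.exp (2 * a 3) * deriv γ₁ s) (σ u) =
      Real.exp (2 * a 3) * deriv (deriv γ₁) (σ u) := by simp
  rw [d3]
  apply mul_eq_zero_of_left
  linear_combination Real.exp (2 * a 3) * hode' +
    3 * Real.exp (2 * a 3) * deriv γ₁ (σ u) ^ 3 * e1

end Hypersurface

/-! ### The two types of points of an umbilical hypersurface -/

section Types

variable {M : Type*} [TopologicalSpace M] [ChartedSpace (EuclideanSpace ℝ (Fin 3)) M]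
  [IsManifold (𝓡 3) ∞ M] {F : M → Sol40}
  {e : OpenPartialHomeomorph M (EuclideanSpace ℝ (Fin 3))}
  {n : EuclideanSpace ℝ (Fin 3) → Fin 4 → ℝ} {l : EuclideanSpace ℝ (Fin 3) → ℝ}

/-- The tangent space of the hypersurface at `p`, as a set of vectors of `ℝ⁴`. -/
def tangentSet (F : M → Sol40) (p : M) : Set Sol40 :=
  range fun w : EuclideanSpace ℝ (Fin 3) => (mfderiv (𝓡 3) (𝓡 4) F p w : Sol40)

/-- The tangent space does not depend on the chart, so conditions on it can be compared across
charts, unlike the chartwise choices of unit normal. -/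
theorem IsImmersedHypersurface.tangentSet_eq (hF : IsImmersedHypersurface F)
    (he : e ∈ IsManifold.maximalAtlas (𝓡 3) ∞ M) {u : EuclideanSpace ℝ (Fin 3)}
    (hu : u ∈ e.target) : tangentSet F (e.symm u) = range (fderiv ℝ (F ∘ e.symm) u) := by
  have hed : e.MDifferentiable (𝓡 3) (𝓡 3) :=
    ⟨(contMDiffOn_of_mem_maximalAtlas he).mdifferentiableOn (by simp),
      (contMDiffOn_symm_of_mem_maximalAtlas he).mdifferentiableOn (by simp)⟩
  have hFd : MDifferentiableAt (𝓡 3) (𝓡 4) F (e.symm u) := hF.1.mdifferentiableAt (by simp)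
  have h1 : mfderiv (𝓡 3) (𝓡 4) (F ∘ e.symm) u = _ :=
    mfderiv_comp u hFd (hed.mdifferentiableAt_symm hu)
  have hsurj := hed.symm.mfderiv_surjective (x := u) hu
  rw [← mfderiv_eq_fderiv, h1]
  exact (hsurj.range_comp _).symm

/-- `∂x` and `∂y` are tangent to the hypersurface. -/
def HasHorizontalTangent (F : M → Sol40) (p : M) : Prop :=
  ∀ y : Sol40, y 2 = 0 → y 3 = 0 → y ∈ tangentSet F p

/-- `∂z` and `∂t` are tangent to the hypersurface. -/
def HasVerticalTangent (F : M → Sol40) (p : M) : Prop :=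
  ∀ y : Sol40, y 0 = 0 → y 1 = 0 → y ∈ tangentSet F p

theorem IsUnitNormalOn.mem_tangentSet_iff (hF : IsImmersedHypersurface F)
    (he : e ∈ IsManifold.maximalAtlas (𝓡 3) ∞ M)
    (hn : IsUnitNormalOn e.target (F ∘ e.symm) n) {u : EuclideanSpace ℝ (Fin 3)}
    (hu : u ∈ e.target) (y : Sol40) :
    y ∈ tangentSet F (e.symm u) ↔ ∑ k, n u k * solFrame ((F ∘ e.symm) u 3) y k = 0 := by
  rw [hF.tangentSet_eq he hu]
  constructor
  · rintro ⟨w, rfl⟩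
    exact hn.normal u hu w
  · intro h
    obtain ⟨w, hw⟩ := hn.exists_frame_eq hu (hF.injective_fderiv_chart he hu) h
    exact ⟨w, solFrame_injective _ hw⟩

theorem IsUnitNormalOn.hasHorizontalTangent_iff (hF : IsImmersedHypersurface F)
    (he : e ∈ IsManifold.maximalAtlas (𝓡 3) ∞ M)
    (hn : IsUnitNormalOn e.target (F ∘ e.symm) n) {u : EuclideanSpace ℝ (Fin 3)}
    (hu : u ∈ e.target) : HasHorizontalTangent F (e.symm u) ↔ n u 0 = 0 ∧ n u 1 = 0 := by
  constructor
  · intro h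
    have h0 := (hn.mem_tangentSet_iff hF he hu _).1 (h !₂[1, 0, 0, 0] rfl rfl)
    have h1 := (hn.mem_tangentSet_iff hF he hu _).1 (h !₂[0, 1, 0, 0] rfl rfl)
    simp [Fin.sum_univ_four, solFrame] at h0 h1
    exact ⟨h0, h1⟩
  · rintro ⟨h0, h1⟩ y h2 h3
    rw [hn.mem_tangentSet_iff hF he hu]
    simp [Fin.sum_univ_four, solFrame, h0, h1, h2, h3]

theorem IsUnitNormalOn.hasVerticalTangent_iff (hF : IsImmersedHypersurface F)
    (he : e ∈ IsManifold.maximalAtlas (𝓡 3) ∞ M)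
    (hn : IsUnitNormalOn e.target (F ∘ e.symm) n) {u : EuclideanSpace ℝ (Fin 3)}
    (hu : u ∈ e.target) : HasVerticalTangent F (e.symm u) ↔ n u 2 = 0 ∧ n u 3 = 0 := by
  constructor
  · intro h
    have h0 := (hn.mem_tangentSet_iff hF he hu _).1 (h !₂[0, 0, 1, 0] rfl rfl)
    have h1 := (hn.mem_tangentSet_iff hF he hu _).1 (h !₂[0, 0, 0, 1] rfl rfl)
    simp [Fin.sum_univ_four, solFrame] at h0 h1
    exact ⟨h0, h1⟩
  · rintro ⟨h0, h1⟩ y h2 h3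
    rw [hn.mem_tangentSet_iff hF he hu]
    simp [Fin.sum_univ_four, solFrame, h0, h1, h2, h3]

theorem IsTotallyUmbilical.exists_isUmbilicalWith (hF : IsImmersedHypersurface F)
    (h : IsTotallyUmbilical F) (he : e ∈ IsManifold.maximalAtlas (𝓡 3) ∞ M) :
    ∃ n l, IsUmbilicalWith e.target (F ∘ e.symm) n l :=
  _root_.exists_isUmbilicalWith e.open_target (hF.contDiffOn_chart he)
    (fun _ hu => hF.injective_fderiv_chart he hu) fun u hu => h e he u hu

/-- The dichotomy together with `|n| = 1` makes the two properties complementary. Each is the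
failure of a closed condition on `n`, hence open, so both are clopen. -/
theorem IsTotallyUmbilical.horizontal_or_vertical [PreconnectedSpace M]
    (hF : IsImmersedHypersurface F) (h : IsTotallyUmbilical F) :
    (∀ p, HasHorizontalTangent F p) ∨ ∀ p, HasVerticalTangent F p := by
  have hchart : ∀ p : M, ∃ n, IsUnitNormalOn (chartAt (EuclideanSpace ℝ (Fin 3)) p).target
      (F ∘ (chartAt (EuclideanSpace ℝ (Fin 3)) p).symm) n ∧
      ∀ u ∈ (chartAt (EuclideanSpace ℝ (Fin 3)) p).target,
        (n u 0 = 0 ∧ n u 1 = 0) ∨ (n u 2 = 0 ∧ n u 3 = 0) := by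
    intro p
    obtain ⟨n, l, hnl⟩ := h.exists_isUmbilicalWith hF (IsManifold.chart_mem_maximalAtlas p)
    exact ⟨n, hnl.toIsUnitNormalOn, fun u hu => hnl.dichotomy hu⟩
  have hor : ∀ p, ¬ HasHorizontalTangent F p ↔ HasVerticalTangent F p := by
    intro p
    obtain ⟨n, hn, hd⟩ := hchart p
    have he := IsManifold.chart_mem_maximalAtlas (I := 𝓡 3) (n := ∞) p
    have hu := mem_chart_target (EuclideanSpace ℝ (Fin 3)) p
    have h1 := hn.hasHorizontalTangent_iff hF he hu
    have h2 := hn.hasVerticalTangent_iff hF he hu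
    rw [OpenPartialHomeomorph.left_inv _ (mem_chart_source _ p)] at h1 h2
    rw [h1, h2]
    constructor
    · exact (hd _ hu).resolve_left
    · intro h3 h4
      have := hn.unit _ hu
      simp [Fin.sum_univ_four, h3, h4] at this
  have hopen : IsOpen {p | HasHorizontalTangent F p} ∧ IsOpen {p | HasVerticalTangent F p} := by
    have key : ∀ (p : M) (i j : Fin 4) (n : EuclideanSpace ℝ (Fin 3) → Fin 4 → ℝ),
        IsUnitNormalOn (chartAt (EuclideanSpace ℝ (Fin 3)) p).target
          (F ∘ (chartAt (EuclideanSpace ℝ (Fin 3)) p).symm) n →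
        ¬ (n (chartAt (EuclideanSpace ℝ (Fin 3)) p p) i = 0 ∧
          n (chartAt (EuclideanSpace ℝ (Fin 3)) p p) j = 0) →
        ∀ᶠ q in nhds p, ¬ (n (chartAt (EuclideanSpace ℝ (Fin 3)) p q) i = 0 ∧
          n (chartAt (EuclideanSpace ℝ (Fin 3)) p q) j = 0) := by
      intro p i j n hn h0
      have hc : ContinuousAt n (chartAt (EuclideanSpace ℝ (Fin 3)) p p) :=
        hn.contDiffOn.continuousOn.continuousAt ((chartAt _ p).open_target.mem_nhds
          (mem_chart_target _ p))
      have hc' : ContinuousAt (fun q => n (chartAt (EuclideanSpace ℝ (Fin 3)) p q)) p :=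
        hc.comp ((chartAt _ p).continuousAt (mem_chart_source _ p))
      have hci := fun k => (continuous_apply k).continuousAt.comp hc'
      by_cases hi : n (chartAt (EuclideanSpace ℝ (Fin 3)) p p) i = 0
      · have hj := fun h => h0 ⟨hi, h⟩
        filter_upwards [(hci j).eventually_ne hj] with q hq hq' using hq hq'.2
      · filter_upwards [(hci i).eventually_ne hi] with q hq hq' using hq hq'.1
    constructor
    · rw [isOpen_iff_mem_nhds]
      intro p hp
      obtain ⟨n, hn, -⟩ := hchart p
      have he := IsManifold.chart_mem_maximalAtlas (I := 𝓡 3) (n := ∞) p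
      have hs := mem_chart_source (EuclideanSpace ℝ (Fin 3)) p
      have h1 : ∀ q ∈ (chartAt (EuclideanSpace ℝ (Fin 3)) p).source, HasHorizontalTangent F q ↔
          ¬ (n (chartAt (EuclideanSpace ℝ (Fin 3)) p q) 2 = 0 ∧
            n (chartAt (EuclideanSpace ℝ (Fin 3)) p q) 3 = 0) := by
        intro q hq
        rw [← hn.hasVerticalTangent_iff hF he (OpenPartialHomeomorph.map_source _ hq),
          OpenPartialHomeomorph.left_inv _ hq, ← hor, not_not]
      filter_upwards [key p 2 3 n hn ((h1 p hs).1 hp),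
        (chartAt (EuclideanSpace ℝ (Fin 3)) p).open_source.mem_nhds hs] with q h3 h4
        using (h1 q h4).2 h3
    · rw [isOpen_iff_mem_nhds]
      intro p hp
      obtain ⟨n, hn, -⟩ := hchart p
      have he := IsManifold.chart_mem_maximalAtlas (I := 𝓡 3) (n := ∞) p
      have hs := mem_chart_source (EuclideanSpace ℝ (Fin 3)) p
      have h1 : ∀ q ∈ (chartAt (EuclideanSpace ℝ (Fin 3)) p).source, HasVerticalTangent F q ↔
          ¬ (n (chartAt (EuclideanSpace ℝ (Fin 3)) p q) 0 = 0 ∧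
            n (chartAt (EuclideanSpace ℝ (Fin 3)) p q) 1 = 0) := by
        intro q hq
        rw [← hn.hasHorizontalTangent_iff hF he (OpenPartialHomeomorph.map_source _ hq),
          OpenPartialHomeomorph.left_inv _ hq, hor]
      filter_upwards [key p 0 1 n hn ((h1 p hs).1 hp),
        (chartAt (EuclideanSpace ℝ (Fin 3)) p).open_source.mem_nhds hs] with q h3 h4
        using (h1 q h4).2 h3
  have hcl : IsClopen {p | HasHorizontalTangent F p} := by
    refine ⟨⟨?_⟩, hopen.1⟩
    have : {p | HasHorizontalTangent F p}ᶜ = {p | HasVerticalTangent F p} := by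
      ext p; exact hor p
    rw [this]; exact hopen.2
  rcases isClopen_iff.1 hcl with h0 | h0
  · right
    intro p
    rw [← hor]
    intro hp
    have : p ∈ {p | HasHorizontalTangent F p} := hp
    rw [h0] at this
    exact this
  · left
    intro p
    have : p ∈ {p | HasHorizontalTangent F p} := by rw [h0]; trivial
    exact this

/-! ### Hypersurfaces that contain the directions `∂z` and `∂t` -/

/-- The hypersurface touches the vertical hyperplane with angle `α` and offset `c` at `p`. -/
def TouchesVertical (F : M → Sol40) (α c : ℝ) (p : M) : Prop :=
  F p ∈ verticalHyperplane α c ∧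
    ∀ y ∈ tangentSet F p, y 0 * Real.cos α + y 1 * Real.sin α = 0

theorem fderiv_vertical {X : EuclideanSpace ℝ (Fin 3) → Sol40} {u : EuclideanSpace ℝ (Fin 3)}
    (hX : DifferentiableAt ℝ X u) (α : ℝ) :
    DifferentiableAt ℝ (fun u => X u 0 * Real.cos α + X u 1 * Real.sin α) u ∧
    ∀ w, fderiv ℝ (fun u => X u 0 * Real.cos α + X u 1 * Real.sin α) u w =
      fderiv ℝ X u w 0 * Real.cos α + fderiv ℝ X u w 1 * Real.sin α := by
  have h0 := (EuclideanSpace.proj 0 : Sol40 →L[ℝ] ℝ).hasFDerivAt.comp u hX.hasFDerivAt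
  have h1 := (EuclideanSpace.proj 1 : Sol40 →L[ℝ] ℝ).hasFDerivAt.comp u hX.hasFDerivAt
  have h2 : HasFDerivAt (fun u => X u 0 * Real.cos α + X u 1 * Real.sin α) _ u :=
    (h0.mul_const (Real.cos α)).add (h1.mul_const (Real.sin α))
  refine ⟨h2.differentiableAt, fun w => ?_⟩
  rw [h2.fderiv]
  simp [mul_comm]

/-- On a ball in a chart the normal is constant, so touching a given hyperplane propagates over the
whole ball. Symmetry in `q` and `q'` makes the set of touching points both open and closed. -/
theorem IsTotallyUmbilical.eventually_touchesVertical (hF : IsImmersedHypersurface F)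
    (h : IsTotallyUmbilical F) (hv : ∀ p, HasVerticalTangent F p) (p : M) :
    ∃ V : Set M, IsOpen V ∧ p ∈ V ∧ ∀ q ∈ V, ∀ q' ∈ V, ∀ α c,
      TouchesVertical F α c q → TouchesVertical F α c q' := by
  set e := chartAt (EuclideanSpace ℝ (Fin 3)) p with hedef
  have he : e ∈ IsManifold.maximalAtlas (𝓡 3) ∞ M := IsManifold.chart_mem_maximalAtlas p
  have hp : p ∈ e.source := mem_chart_source _ p
  obtain ⟨n, l, hnl⟩ := h.exists_isUmbilicalWith hF he
  have hn23 : ∀ u ∈ e.target, n u 2 = 0 ∧ n u 3 = 0 := fun u hu =>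
    (hnl.toIsUnitNormalOn.hasVerticalTangent_iff hF he hu).1 (hv _)
  obtain ⟨r, hr, hball⟩ := Metric.isOpen_iff.1 e.open_target (e p) (e.map_source hp)
  set B := Metric.ball (e p) r with hB
  have hBpre : IsPreconnected B := (convex_ball _ _).isPreconnected
  refine ⟨e.source ∩ e ⁻¹' B, e.isOpen_inter_preimage Metric.isOpen_ball,
    ⟨hp, Metric.mem_ball_self hr⟩, ?_⟩
  rintro q ⟨hq, hqB⟩ q' ⟨hq', hqB'⟩ α c ⟨hFq, htq⟩
  have hconst : ∀ u ∈ B, n u = n (e q) := fun u hu =>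
    Metric.isOpen_ball.is_const_of_fderiv_eq_zero hBpre
      ((hnl.contDiffOn.differentiableOn (by simp)).mono hball)
      (fun u hu => hnl.fderiv_normal_eq_zero hn23 (hball hu)) hu hqB
  have hqt : e q ∈ e.target := e.map_source hq
  have hunit := hnl.unit _ hqt
  have hnq := hn23 _ hqt
  simp only [Fin.sum_univ_four, hnq] at hunit
  -- The vector `(-n₁, n₀, 0, 0)` is tangent, so `cos α dx + sin α dy` kills it: `(cos α, sin α)` is
  -- parallel to `(n₀, n₁)`.
  have hcross : n (e q) 1 * Real.cos α = n (e q) 0 * Real.sin α := by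
    have hmem : (!₂[-n (e q) 1, n (e q) 0, 0, 0] : Sol40) ∈ tangentSet F (e.symm (e q)) := by
      rw [hnl.toIsUnitNormalOn.mem_tangentSet_iff hF he hqt]
      simp [Fin.sum_univ_four, solFrame]; ring
    rw [e.left_inv hq] at hmem
    have := htq _ hmem
    simp at this
    linarith
  have htan : ∀ u ∈ B, ∀ y ∈ tangentSet F (e.symm u), y 0 * Real.cos α + y 1 * Real.sin α = 0 := by
    intro u hu y hy
    have h1 := (hnl.toIsUnitNormalOn.mem_tangentSet_iff hF he (hball hu) y).1 hy
    rw [hconst u hu] at h1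
    simp [Fin.sum_univ_four, solFrame, hnq] at h1
    have hexp := Real.exp_pos (-(F (e.symm u)) 3)
    have h2 : n (e q) 0 * y 0 + n (e q) 1 * y 1 = 0 := by
      have : Real.exp (-(F (e.symm u)) 3) * (n (e q) 0 * y 0 + n (e q) 1 * y 1) = 0 := by
        linear_combination h1
      exact (mul_eq_zero.1 this).resolve_left hexp.ne'
    linear_combination (-(y 0 * Real.cos α + y 1 * Real.sin α)) * hunit +
      (n (e q) 0 * Real.cos α + n (e q) 1 * Real.sin α) * h2 +
      (y 0 * n (e q) 1 - y 1 * n (e q) 0) * hcross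
  have hXd : ∀ u ∈ B, DifferentiableAt ℝ (F ∘ e.symm) u := fun u hu =>
    ((hF.contDiffOn_chart he).contDiffAt (e.open_target.mem_nhds (hball hu))).differentiableAt
      (by simp)
  have hval := Metric.isOpen_ball.is_const_of_fderiv_eq_zero hBpre
    (f := fun u => (F ∘ e.symm) u 0 * Real.cos α + (F ∘ e.symm) u 1 * Real.sin α)
    (fun u hu => (fderiv_vertical (hXd u hu) α).1.differentiableWithinAt)
    (fun u hu => by
      ext1 w
      rw [(fderiv_vertical (hXd u hu) α).2]
      apply htan u hu
      rw [hF.tangentSet_eq he (hball hu)]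
      exact ⟨w, rfl⟩) hqB' hqB
  simp only [Function.comp_apply, e.left_inv hq, e.left_inv hq'] at hval
  refine ⟨hval.trans hFq, ?_⟩
  have := htan _ hqB'
  rwa [e.left_inv hq'] at this

theorem IsTotallyUmbilical.exists_range_subset [ConnectedSpace M] (hF : IsImmersedHypersurface F)
    (h : IsTotallyUmbilical F) (hv : ∀ p, HasVerticalTangent F p) :
    ∃ α c, range F ⊆ verticalHyperplane α c := by
  obtain ⟨p⟩ := (inferInstance : Nonempty M)
  obtain ⟨α, c, hp⟩ : ∃ α c, TouchesVertical F α c p := by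
    set e := chartAt (EuclideanSpace ℝ (Fin 3)) p with hedef
    have he : e ∈ IsManifold.maximalAtlas (𝓡 3) ∞ M := IsManifold.chart_mem_maximalAtlas p
    have hps : p ∈ e.source := mem_chart_source _ p
    obtain ⟨n, l, hnl⟩ := h.exists_isUmbilicalWith hF he
    have hu := e.map_source hps
    have hn23 := (hnl.toIsUnitNormalOn.hasVerticalTangent_iff hF he hu).1 (hv _)
    have hunit := hnl.unit _ hu
    simp only [Fin.sum_univ_four, hn23] at hunit
    -- The angle `α` is the argument of the unit complex number `n₀ + i n₁`; the offset `c` is then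
    -- the value at `F p`.
    set z : ℂ := ⟨n (e p) 0, n (e p) 1⟩ with hz
    have hnorm : ‖z‖ = 1 := by
      rw [Complex.norm_def, Complex.normSq_apply, hz]
      simp only
      rw [show n (e p) 0 * n (e p) 0 + n (e p) 1 * n (e p) 1 = 1 by linarith, Real.sqrt_one]
    have hz0 : z ≠ 0 := by
      intro h0; rw [h0] at hnorm; simp at hnorm
    have hcos : Real.cos z.arg = n (e p) 0 := by rw [Complex.cos_arg hz0, hnorm, div_one]
    have hsin : Real.sin z.arg = n (e p) 1 := by rw [Complex.sin_arg, hnorm, div_one]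
    refine ⟨z.arg, _, rfl, fun y hy => ?_⟩
    have hy' : y ∈ tangentSet F (e.symm (e p)) := by rwa [e.left_inv hps]
    have h1 := (hnl.toIsUnitNormalOn.mem_tangentSet_iff hF he hu y).1 hy'
    simp [Fin.sum_univ_four, solFrame, hn23] at h1
    rw [hcos, hsin]
    have hexp := Real.exp_pos (-(F (e.symm (e p))) 3)
    have : Real.exp (-(F (e.symm (e p))) 3) * (y 0 * n (e p) 0 + y 1 * n (e p) 1) = 0 := by
      linear_combination h1
    exact (mul_eq_zero.1 this).resolve_left hexp.ne'
  have hcl : IsClopen {q | TouchesVertical F α c q} := by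
    constructor
    · rw [← isOpen_compl_iff, isOpen_iff_mem_nhds]
      intro q hq
      obtain ⟨V, hV, hqV, hVt⟩ := h.eventually_touchesVertical hF hv q
      filter_upwards [hV.mem_nhds hqV] with q' hq' ht
      exact hq (hVt q' hq' q hqV α c ht)
    · rw [isOpen_iff_mem_nhds]
      intro q hq
      obtain ⟨V, hV, hqV, hVt⟩ := h.eventually_touchesVertical hF hv q
      filter_upwards [hV.mem_nhds hqV] with q' hq' using hVt q hqV q' hq' α c hq
  have huniv := hcl.eq_univ ⟨p, hp⟩
  refine ⟨α, c, ?_⟩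
  rintro _ ⟨q, rfl⟩
  have : q ∈ {q | TouchesVertical F α c q} := by rw [huniv]; trivial
  exact this.1

end Types

/-! ### Hypersurfaces that contain the directions `∂x` and `∂y` -/

/-- The coordinates `x`, `y` and the `k`-th coordinate. -/
def horizontalCoord (k : Fin 4) : Sol40 →L[ℝ] EuclideanSpace ℝ (Fin 3) :=
  coordMap ![EuclideanSpace.proj 0, EuclideanSpace.proj 1, EuclideanSpace.proj k]

theorem horizontalCoord_zero (k : Fin 4) (v : Sol40) : horizontalCoord k v 0 = v 0 := by
  simp [horizontalCoord, coordMap_apply]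

theorem horizontalCoord_one (k : Fin 4) (v : Sol40) : horizontalCoord k v 1 = v 1 := by
  simp [horizontalCoord, coordMap_apply]

theorem horizontalCoord_two (k : Fin 4) (v : Sol40) : horizontalCoord k v 2 = v k := by
  simp [horizontalCoord, coordMap_apply]

/-- A function on a convex open set is constant along segments on which its derivative
vanishes. -/
theorem eq_of_fderiv_apply_sub_eq_zero {E : Type*} [NormedAddCommGroup E] [NormedSpace ℝ E]
    {B : Set E} (hB : Convex ℝ B) {f : E → ℝ} (hf : ∀ u ∈ B, DifferentiableAt ℝ f u) {u v : E}
    (hu : u ∈ B) (hv : v ∈ B) (h : ∀ x ∈ B, fderiv ℝ f x (v - u) = 0) : f v = f u := by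
  have hmem : ∀ t ∈ Icc (0 : ℝ) 1, u + t • (v - u) ∈ B := fun t ht =>
    hB.add_smul_sub_mem hu hv ht
  have hd : ∀ t ∈ Icc (0 : ℝ) 1, HasDerivAt (fun t : ℝ => f (u + t • (v - u))) 0 t := by
    intro t ht
    have h1 : HasDerivAt (fun t : ℝ => u + t • (v - u)) (v - u) t := by
      simpa using ((hasDerivAt_id t).smul_const (v - u)).const_add u
    have h2 := (hf _ (hmem t ht)).hasFDerivAt.comp_hasDerivAt t h1
    rwa [h _ (hmem t ht)] at h2
  have := constant_of_has_deriv_right_zero (f := fun t : ℝ => f (u + t • (v - u)))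
    (fun t ht => (hd t ht).continuousAt.continuousWithinAt)
    (fun t ht => (hd t ⟨ht.1, ht.2.le⟩).hasDerivWithinAt) 1 (right_mem_Icc.2 zero_le_one)
  simpa using this

section Hypersurface

variable {M : Type*} [TopologicalSpace M] [ChartedSpace (EuclideanSpace ℝ (Fin 3)) M]
  [IsManifold (𝓡 3) ∞ M] {F : M → Sol40}
  {e : OpenPartialHomeomorph M (EuclideanSpace ℝ (Fin 3))}

/-- Tangent vectors satisfy one relation between `dz` and `dt`, with coefficients `e^{2t} n₂` and
`n₃` not both zero. If `n₃ ≠ 0`, `z` can be the third coordinate; otherwise `t` can. -/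
theorem IsTotallyUmbilical.exists_isTransverseAt (hF : IsImmersedHypersurface F)
    (h : IsTotallyUmbilical F) {p : M} (hh : HasHorizontalTangent F p) :
    ∃ k : Fin 4, (k = 2 ∨ k = 3) ∧ IsTransverseAt (horizontalCoord k) F p := by
  have he := IsManifold.chart_mem_maximalAtlas (I := 𝓡 3) (n := ∞) p
  have hu := mem_chart_target (EuclideanSpace ℝ (Fin 3)) p
  have hinj := hF.injective_fderiv_chart he hu
  obtain ⟨n, l, hnl⟩ := h.exists_isUmbilicalWith hF he
  have hn01 := (hnl.toIsUnitNormalOn.hasHorizontalTangent_iff hF he hu).1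
    (by rwa [OpenPartialHomeomorph.left_inv _ (mem_chart_source _ p)])
  have hnormal := hnl.normal _ hu
  have hunit := hnl.unit _ hu
  simp only [Fin.sum_univ_four, hn01] at hunit
  simp [Fin.sum_univ_four, solFrame, hn01] at hnormal
  unfold IsTransverseAt
  set X := F ∘ (chartAt (EuclideanSpace ℝ (Fin 3)) p).symm with hX
  set u := chartAt (EuclideanSpace ℝ (Fin 3)) p p with hudef
  by_cases h3 : n u 3 = 0
  · have h2 : n u 2 ≠ 0 := by
      intro h2; rw [h2, h3] at hunit; norm_num at hunit
    refine ⟨3, Or.inr rfl, fun v w hvw => hinj ?_⟩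
    have e0 := congrArg (fun z : EuclideanSpace ℝ (Fin 3) => z 0) hvw
    have e1 := congrArg (fun z : EuclideanSpace ℝ (Fin 3) => z 1) hvw
    have e2 := congrArg (fun z : EuclideanSpace ℝ (Fin 3) => z 2) hvw
    simp only [horizontalCoord_zero, horizontalCoord_one, horizontalCoord_two] at e0 e1 e2
    have hv := hnormal v
    have hw := hnormal w
    simp [h3, h2] at hv hw
    ext k
    fin_cases k
    · exact e0
    · exact e1
    · exact hv.trans hw.symm
    · exact e2
  · refine ⟨2, Or.inl rfl, fun v w hvw => hinj ?_⟩
    have e0 := congrArg (fun z : EuclideanSpace ℝ (Fin 3) => z 0) hvw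
    have e1 := congrArg (fun z : EuclideanSpace ℝ (Fin 3) => z 1) hvw
    have e2 := congrArg (fun z : EuclideanSpace ℝ (Fin 3) => z 2) hvw
    simp only [horizontalCoord_zero, horizontalCoord_one, horizontalCoord_two] at e0 e1 e2
    have hv := hnormal v
    have hw := hnormal w
    rw [e2] at hv
    ext k
    fin_cases k
    · exact e0
    · exact e1
    · exact e2
    · exact mul_left_cancel₀ h3 (add_left_cancel (hv.trans hw.symm))

/-- The horizontal vector `(w₀, w₁, 0, 0)` is tangent, and in the adapted chart the only parameter
vector mapped to it is `w`. -/
theorem HasHorizontalTangent.fderiv_apply (hF : IsImmersedHypersurface F)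
    (he : e ∈ IsManifold.maximalAtlas (𝓡 3) ∞ M) {k : Fin 4} (hk : k = 2 ∨ k = 3)
    (heF : ∀ q ∈ e.source, e q = horizontalCoord k (F q)) {u : EuclideanSpace ℝ (Fin 3)}
    (hu : u ∈ e.target) (hh : HasHorizontalTangent F (e.symm u)) {w : EuclideanSpace ℝ (Fin 3)}
    (hw : w 2 = 0) : fderiv ℝ (F ∘ e.symm) u w 2 = 0 ∧ fderiv ℝ (F ∘ e.symm) u w 3 = 0 := by
  have hy := hh !₂[w 0, w 1, 0, 0] rfl rfl
  rw [hF.tangentSet_eq he hu] at hy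
  obtain ⟨w', hw'⟩ := hy
  have h1 := hF.comp_fderiv_eq he heF hu w'
  rw [hw'] at h1
  have hww : w' = w := by
    rw [← h1]
    ext i
    fin_cases i
    · simp [horizontalCoord_zero]
    · simp [horizontalCoord_one]
    · simp only [Fin.reduceFinMk, horizontalCoord_two, hw]
      rcases hk with rfl | rfl <;> rfl
  rw [← hww, hw']
  exact ⟨rfl, rfl⟩

/-- Since `∂₀` annihilates the parameter `u₂`, the `(0,0)` entry identifies the umbilicity factor as
`γ₁'`. In the `(2,2)` entry the multiples of `g` then cancel, leaving the equation. -/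
theorem IsCylindrical.ode_of_umbilicalAt {Ω : Set (EuclideanSpace ℝ (Fin 3))}
    {X : EuclideanSpace ℝ (Fin 3) → Sol40} {J : Set ℝ} {γ₁ γ₂ : ℝ → ℝ}
    (h : IsCylindrical Ω X (fun u => u 2) J γ₁ γ₂) {u : EuclideanSpace ℝ (Fin 3)} (hu : u ∈ Ω)
    (humb : UmbilicalAt X u) :
    deriv (deriv γ₁) (u 2) * deriv γ₂ (u 2) - deriv γ₁ (u 2) * deriv (deriv γ₂) (u 2)
        + 5 * deriv γ₁ (u 2) * deriv γ₂ (u 2) ^ 2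
        + 3 * Real.exp (4 * γ₂ (u 2)) * deriv γ₁ (u 2) ^ 3 = 0 := by
  obtain ⟨l, hl⟩ := (umbilical_iff_exists (h.injective u hu) (h.conormal_ne_zero hu)
    (h.annihilator hu)).1 humb
  have hσ : ∀ i : Fin 3, pderiv i (fun u : EuclideanSpace ℝ (Fin 3) => u 2) u =
      if i = 2 then 1 else 0 := fun i =>
    pderiv_of_hasDerivAt_coord (f := id) 2 i u (hasDerivAt_id _)
  have h0 := hl 0 0
  have h2 := hl 2 2
  rw [h.sum_mul_covDeriv hu, hσ] at h0 h2
  have hg : inducedMetric solMetric X u 0 0 ≠ 0 := by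
    intro hg
    have h1 : pderiv 0 X u = 0 := eq_zero_of_bilin_solMetric_self hg
    have h2 := h.injective u hu (h1.trans (map_zero (fderiv ℝ X u)).symm)
    simpa using congrArg (fun v : EuclideanSpace ℝ (Fin 3) => v 0) h2
  have h3 : deriv γ₁ (u 2) = l := by
    apply mul_right_cancel₀ hg
    simpa using h0
  rw [h3] at h2
  simp only [if_true, mul_one] at h2
  rw [h3]
  linarith

theorem IsTotallyUmbilical.isCylinderOverProfileCurve (hF : IsImmersedHypersurface F)
    (h : IsTotallyUmbilical F) (hh : ∀ p, HasHorizontalTangent F p) :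
    IsCylinderOverProfileCurve F := by
  intro p
  obtain ⟨k, hk, hL⟩ := h.exists_isTransverseAt hF (hh p)
  obtain ⟨e, he, hp, heF, r, hr, htarget⟩ := hF.exists_chart_of_isTransverseAt hL
  set c := horizontalCoord k (F p) with hc
  set X := F ∘ e.symm with hX
  have hXC := hF.contDiffOn_chart he
  -- The diameter of the ball parallel to the third axis; `F` along it gives the profile curve. Each
  -- `u` in the ball is joined to `γ (u 2)` by a segment inside the ball along which `z` and `t` are
  -- constant.
  set γ : ℝ → EuclideanSpace ℝ (Fin 3) := fun s => !₂[c 0, c 1, s] with hγ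
  set J := Ioo (c 2 - r) (c 2 + r) with hJ
  have hγJ : ∀ s ∈ J, γ s ∈ e.target := by
    intro s hs
    rw [htarget, Metric.mem_ball, EuclideanSpace.dist_eq]
    have : ∑ i, dist (γ s i) (c i) ^ 2 = (s - c 2) ^ 2 := by
      simp [Fin.sum_univ_three, hγ, Real.dist_eq, sq_abs]
    rw [this, Real.sqrt_sq_eq_abs, abs_lt]
    constructor <;> linarith [hs.1, hs.2]
  have hmem : ∀ u ∈ e.target, u 2 ∈ J := by
    intro u hu
    rw [htarget, Metric.mem_ball] at hu
    have h1 : dist (u 2) (c 2) ≤ dist u c := by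
      rw [Real.dist_eq, dist_eq_norm, ← Real.norm_eq_abs]
      exact PiLp.norm_apply_le (u - c) 2
    have h2 := abs_lt.1 (lt_of_le_of_lt (by rwa [Real.dist_eq] at h1) hu)
    exact ⟨by linarith [h2.1], by linarith [h2.2]⟩
  have hγC : ContDiff ℝ ∞ γ := by
    rw [contDiff_euclidean]
    intro i
    fin_cases i
    · exact contDiff_const
    · exact contDiff_const
    · exact contDiff_id
  have hXγ : ContDiffOn ℝ ∞ (fun s => X (γ s)) J := hXC.comp hγC.contDiffOn hγJ
  have hcomp : ∀ j : Fin 4, ContDiffOn ℝ ∞ (fun s => X (γ s) j) J := fun j =>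
    (EuclideanSpace.proj j : Sol40 →L[ℝ] ℝ).contDiff.comp_contDiffOn hXγ
  have hXd : ∀ u ∈ e.target, DifferentiableAt ℝ X u := fun u hu =>
    (hXC.contDiffAt (e.open_target.mem_nhds hu)).differentiableAt (by simp)
  have hconv : Convex ℝ e.target := by rw [htarget]; exact convex_ball _ _
  have hconst : ∀ j : Fin 4, (j = 2 ∨ j = 3) → ∀ u ∈ e.target, X u j = X (γ (u 2)) j := by
    intro j hj u hu
    refine eq_of_fderiv_apply_sub_eq_zero hconv (f := fun u => X u j)
      (fun u hu => (EuclideanSpace.proj j : Sol40 →L[ℝ] ℝ).differentiableAt.comp u (hXd u hu))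
      (hγJ _ (hmem u hu)) hu fun x hx => ?_
    rw [fderiv_coord (hXd x hx)]
    have := HasHorizontalTangent.fderiv_apply hF he hk heF hx (hh _) (w := u - γ (u 2))
      (by simp [hγ])
    rcases hj with rfl | rfl
    exacts [this.1, this.2]
  have hcyl : IsCylindrical e.target X (fun u => u 2) J (fun s => X (γ s) 2)
      (fun s => X (γ s) 3) :=
    { isOpen := e.open_target
      contDiffOn := hXC
      injective := fun u hu => hF.injective_fderiv_chart he hu
      contDiffOn_param := (EuclideanSpace.proj 2 : EuclideanSpace ℝ (Fin 3) →L[ℝ] ℝ).contDiff.contDiffOn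
      mapsTo := hmem
      isOpen_interval := isOpen_Ioo
      contDiffOn_fst := hcomp 2
      contDiffOn_snd := hcomp 3
      apply_two := hconst 2 (Or.inl rfl)
      apply_three := hconst 3 (Or.inr rfl) }
  refine ⟨e, he, hp, J, fun s => X (γ s) 2, fun s => X (γ s) 3, isOpen_Ioo, ordConnected_Ioo,
    hcomp 2, hcomp 3, fun s hs => ?_, fun u hu => ⟨hmem u hu, ?_⟩⟩
  · have := hcyl.ode_of_umbilicalAt (hγJ s hs) (h e he _ (hγJ s hs))
    have hs2 : γ s 2 = s := rfl
    rwa [hs2] at this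
  · have h1 := OpenPartialHomeomorph.eq_comp_symm_of_eq heF hu
    change X u = _
    ext j
    fin_cases j
    · change X u 0 = u 0
      rw [← horizontalCoord_zero k, h1]
    · change X u 1 = u 1
      rw [← horizontalCoord_one k, h1]
    · exact hconst 2 (Or.inl rfl) u hu
    · exact hconst 3 (Or.inr rfl) u hu

end Hypersurface

end

/-! ### The classification -/

theorem theorem5p2 {M : Type*} [TopologicalSpace M] [T2Space M] [SecondCountableTopology M]
    [ConnectedSpace M] [ChartedSpace (EuclideanSpace ℝ (Fin 3)) M] [IsManifold (𝓡 3) ∞ M]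
    (F : M → Sol40) (hF : IsImmersedHypersurface F) :
    (IsTotallyUmbilical F →
      (∃ α c : ℝ, IsOpenPieceOf F (verticalHyperplane α c) ∧ IsTotallyGeodesic F ∧
        ¬ HasConstantSectionalCurvature F) ∨
      IsCylinderOverProfileCurve F) ∧
    (∀ α c : ℝ, range F ⊆ verticalHyperplane α c →
      IsTotallyUmbilical F ∧ IsTotallyGeodesic F ∧ ¬ HasConstantSectionalCurvature F) ∧
    (∀ a : Sol40, IsCylinderOverProfileCurve (fun p => solMul a (F p)) →
      IsTotallyUmbilical F) := by
  refine ⟨fun h => ?_, fun α c hP => ?_, fun a h =>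
    isTotallyUmbilical_of_isCylinderOverProfileCurve hF h⟩
  · rcases h.horizontal_or_vertical hF with hh | hv
    · exact Or.inr (h.isCylinderOverProfileCurve hF hh)
    · obtain ⟨α, c, hP⟩ := h.exists_range_subset hF hv
      exact Or.inl ⟨α, c, isOpenPieceOf_of_isTransverseAt hF (isTransverseAt_verticalCoord hF hP)
        (injOn_verticalCoord α c) fun p => hP ⟨p, rfl⟩,
        isTotallyGeodesic_of_range_subset hF hP,
        not_hasConstantSectionalCurvature_of_range_subset hF hP⟩
  · have hg := isTotallyGeodesic_of_range_subset hF hP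
    exact ⟨hg.isTotallyUmbilical, hg, not_hasConstantSectionalCurvature_of_range_subset hF hP⟩
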